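/- Let $\mathbb T=\mathbb R/\mathbb Z$ (identified with $[0,1]$) and $\mathcal Y=[0,1)$; let $P\in\mathbb R$ and let $V:\mathbb T\times\mathbb R\to\mathbb R$, $(x,y)\mapsto V(x,y)$, be smooth and $1$-periodic in $y$. Let $\epsilon$ run through a sequence of positive numbers converging to $0$, and for each such $\epsilon$ let $(u_\epsilon,m_\epsilon,\overline H_\epsilon)\in C^\infty(\mathbb T)\times C^\infty(\mathbb T)\times\mathbb R$, with $m_\epsilon>0$, solve on $[0,1]$ $$\frac{(P+(u_\epsilon)_x)^2}{2}+V\Big(x,\frac x\epsilon\Big)=\ln m_\epsilon+\overline H_\epsilon,\qquad -\big(m_\epsilon(P+(u_\epsilon)_x)\big)_x=0,\qquad \int_0^1u_\epsilon\,dx=0,\quad \int_0^1 m_\epsilon\,dx=1 .$$ Set $j_\epsilon=m_\epsilon(P+(u_\epsilon)_x)$, which is constant in $x$. A sequence $(w_\epsilon)$ in $L^q(\mathbb T)$ weakly two-scale converges to $w\in L^q(\mathbb T\times\mathcal Y)$ if $\int_0^1w_\epsilon(x)\psi(x,x/\epsilon)\,dx\to\int_0^1\int_0^1 w(x,y)\psi(x,y)\,dy\,dx$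 for every smooth $\psi$ on $\mathbb R^2$ that is $1$-periodic in each variable; it strongly two-scale converges to $w$ if moreover $\|w_\epsilon\|_{L^q(\mathbb T)}\to\|w\|_{L^q(\mathbb T\times\mathcal Y)}$. Fix $q\in[1,\infty)$. Let $W^{1,q}_\#(\mathcal Y)$ be the $1$-periodic functions in $W^{1,q}$. Then $(m_\epsilon)_\epsilon$ is uniformly bounded in $L^\infty(\mathbb T)$, and there are a subsequence of $\epsilon$ and limits $u_0\in C^{0,\alpha}(\mathbb T)\cap W^{1,q}(\mathbb T)$ for some $\alpha\in(0,1)$, with $\int_0^1u_0\,dx=0$, $u_1\in L^q(\mathbb T;W^{1,q}_\#(\mathcal Y)/\mathbb R)$, $m\in L^1(\mathbb T\times\mathcal Y)$ with $\int_0^1\int_0^1 m\,dy\,dx=1$, and $\overline H,j\in\mathbb R$ such that, along the subsequence, $$(\ast)\quad\begin{aligned}&u_\epsilon\to u_0\text{ in }L^\infty(\mathbb T)\text{ and weakly in }W^{1,q}(\mathbb T),\quad (u_\epsilon)_x\text{ weakly two-scale converges to }(u_0)_x+(u_1)_y\text{ in }L^q(\mathbb T\times\mathcal Y),\\ &m_\epsilon\text{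 weakly two-scale converges to }m\text{ in }L^1(\mathbb T\times\mathcal Y),\quad m_\epsilon\rightharpoonup\int_{\mathcal Y}m(\cdot,y)\,dy\text{ in }L^1(\mathbb T),\quad \overline H_\epsilon\to\overline H,\quad j_\epsilon\to j.\end{aligned}$$ Moreover, whenever $(u_0,u_1,m,\overline H,j)$, in these spaces and with these normalizations, satisfies $(\ast)$ along some subsequence, the following holds. Let $F(t)=\frac{j^2}{2t^2}-\ln t$ for $t>0$, a decreasing bijection of $(0,\infty)$ onto $\mathbb R$. For almost every $(x,y)\in\mathbb T\times\mathcal Y$, $$m(x,y)=F^{-1}\big(\overline H-V(x,y)\big)>0,$$ and, along that subsequence, $m_\epsilon$ strongly two-scale converges to $m$ in $L^p(\mathbb T\times\mathcal Y)$ for all $p\in(1,\infty)$. Furthermore, $1/m$ is integrable on $\mathbb T\times\mathcal Y$, $$j=\frac{P}{\int_0^1\int_0^1\frac1{m(x,y)}\,dy\,dx},$$ $$u_0(x)=\int_0^x\int_0^1\frac{j}{m(s,y)}\,dy\,ds-Px+\frac P2-\int_0^1\int_0^z\int_0^1\frac{j}{m(s,y)}\,dy\,ds\,dz\qquad(x\in[0,1]),$$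 and, for almost every $x\in\mathbb T$, with $u_1(x,\cdot)$ denoting its continuous $1$-periodic representative, $$u_1(x,y)=u_1(x,0)+\int_0^y\frac{j}{m(x,s)}\,ds-y\int_0^1\frac{j}{m(x,z)}\,dz\qquad(y\in[0,1]).$$ -/

import Mathlib

open Set Filter Topology MeasureTheory
open scoped ENNReal NNReal ContDiff

noncomputable section

namespace PeriodicMFG

/-! Functions on the torus `ℝ/ℤ`, and `𝒴`-periodic functions, are `1`-periodic functions on `ℝ`;
`Lᵖ` classes on the torus (or on the cell `𝒴`) are functions on `ℝ` seen through the following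
measure. -/

/-- Lebesgue measure on the unit cell. -/
def cell : Measure ℝ := volume.restrict (Ioc (0 : ℝ) 1)

/-- Lebesgue measure on `𝕋 × 𝒴`. -/
def cell2 : Measure (ℝ × ℝ) := cell.prod cell

/-- `u ∈ C^∞(𝕋)`; also `u ∈ C^∞_#(𝒴)`. -/
def SmoothPeriodic (u : ℝ → ℝ) : Prop :=
  ContDiff ℝ ∞ u ∧ Function.Periodic u 1

/-- `ψ ∈ C^∞(𝕋; C^∞_#(𝒴))`: jointly smooth, and `1`-periodic in each variable. -/
def SmoothPeriodic2 (ψ : ℝ → ℝ → ℝ) : Prop :=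
  ContDiff ℝ ∞ (fun z : ℝ × ℝ => ψ z.1 z.2) ∧
    (∀ x y, ψ (x + 1) y = ψ x y) ∧ (∀ x y, ψ x (y + 1) = ψ x y)

/-- The one-dimensional stationary mean-field game with potential `V(x, x/ε)`; the torus is
identified with `[0,1]`. -/
structure IsMFGSolution (P : ℝ) (V : ℝ → ℝ → ℝ) (ε : ℝ) (u m : ℝ → ℝ) (H : ℝ) : Prop where
  smooth_u : SmoothPeriodic u
  smooth_m : SmoothPeriodic m
  m_pos : ∀ x, 0 < m x
  hamilton_jacobi : ∀ x ∈ Icc (0 : ℝ) 1,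
    (P + deriv u x) ^ 2 / 2 + V x (x / ε) = Real.log (m x) + H
  fokker_planck : ∀ x ∈ Icc (0 : ℝ) 1, -deriv (fun s => m s * (P + deriv u s)) x = 0
  mean_u : ∫ x in (0 : ℝ)..1, u x = 0
  mass_m : ∫ x in (0 : ℝ)..1, m x = 1

/-- The current `m (P + u_x)` (a constant function when `(u, m)` solves the game). -/
def current (P : ℝ) (u m : ℝ → ℝ) (x : ℝ) : ℝ := m x * (P + deriv u x)

/-- `w_n ⇀² w` in `L^q(𝕋 × 𝒴)` along the scales `ε_n`. -/
def WeakTwoScale (q : ℝ≥0∞) (ε : ℕ → ℝ) (w : ℕ → ℝ → ℝ) (w₀ : ℝ → ℝ → ℝ) : Prop :=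
  (∀ n, MemLp (w n) q cell) ∧ MemLp (fun z : ℝ × ℝ => w₀ z.1 z.2) q cell2 ∧
    ∀ ψ : ℝ → ℝ → ℝ, SmoothPeriodic2 ψ →
      Tendsto (fun n => ∫ x in (0 : ℝ)..1, w n x * ψ x (x / ε n)) atTop
        (𝓝 (∫ x in (0 : ℝ)..1, ∫ y in (0 : ℝ)..1, w₀ x y * ψ x y))

/-- `w_n →² w` in `L^q(𝕋 × 𝒴)` along the scales `ε_n`. -/
def StrongTwoScale (q : ℝ≥0∞) (ε : ℕ → ℝ) (w : ℕ → ℝ → ℝ) (w₀ : ℝ → ℝ → ℝ) : Prop :=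
  WeakTwoScale q ε w w₀ ∧
    Tendsto (fun n => eLpNorm (w n) q cell) atTop
      (𝓝 (eLpNorm (fun z : ℝ × ℝ => w₀ z.1 z.2) q cell2))

/-- Weak convergence in `L^q(𝕋)`, `1 ≤ q < ∞`: convergence against every function of the dual
space `L^{q'}(𝕋)`. -/
def WeakLq (q : ℝ≥0∞) (w : ℕ → ℝ → ℝ) (w₀ : ℝ → ℝ) : Prop :=
  (∀ n, MemLp (w n) q cell) ∧ MemLp w₀ q cell ∧
    ∀ q' : ℝ≥0∞, ENNReal.HolderConjugate q q' → ∀ g : ℝ → ℝ, MemLp g q' cell →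
      Tendsto (fun n => ∫ x in (0 : ℝ)..1, w n x * g x) atTop
        (𝓝 (∫ x in (0 : ℝ)..1, w₀ x * g x))

/-- `dv` is the weak derivative of `v` on the torus (equivalently, of the `𝒴`-periodic `v`). -/
def IsWeakDeriv (v dv : ℝ → ℝ) : Prop :=
  ∀ φ : ℝ → ℝ, SmoothPeriodic φ →
    ∫ x in (0 : ℝ)..1, v x * deriv φ x = -∫ x in (0 : ℝ)..1, dv x * φ x

/-- `v ∈ W^{1,q}(𝕋)` with weak derivative `dv`. -/
def MemW1q (q : ℝ≥0∞) (v dv : ℝ → ℝ) : Prop :=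
  MemLp v q cell ∧ MemLp dv q cell ∧ IsWeakDeriv v dv

/-- `w` represents an element of `L^q(𝕋; W^{1,q}_#(𝒴)/ℝ)`, with weak `y`-derivative `dw`. Being a
representative modulo constants in `y`, `w` is an `L^q` function up to a function of `x` alone. -/
def MemLqW1qModConst (q : ℝ≥0∞) (w dw : ℝ → ℝ → ℝ) : Prop :=
  (∃ c : ℝ → ℝ, MemLp (fun z : ℝ × ℝ => w z.1 z.2 - c z.1) q cell2) ∧
    MemLp (fun z : ℝ × ℝ => dw z.1 z.2) q cell2 ∧
    ∀ᵐ x ∂cell, IsWeakDeriv (w x) (dw x)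

/-- `(u₀, u₁, m, H, j)` is the limit of the solutions `(u_n, m_n, H_n)` and of their currents
along the scales `ε_n`; the exponent `q` refers to the Sobolev spaces. -/
def IsHomogenizedLimit (P : ℝ) (q : ℝ≥0∞) (ε : ℕ → ℝ) (us ms : ℕ → ℝ → ℝ) (Hs : ℕ → ℝ)
    (u₀ : ℝ → ℝ) (u₁ m : ℝ → ℝ → ℝ) (H j : ℝ) : Prop :=
  Function.Periodic u₀ 1 ∧
  (∃ α : ℝ≥0, 0 < α ∧ α < 1 ∧ ∃ C : ℝ≥0, HolderWith C α u₀) ∧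
  ∫ x in (0 : ℝ)..1, u₀ x = 0 ∧
  Integrable (fun z : ℝ × ℝ => m z.1 z.2) cell2 ∧
  ∫ x in (0 : ℝ)..1, ∫ y in (0 : ℝ)..1, m x y = 1 ∧
  (∃ (du₀ : ℝ → ℝ) (du₁ : ℝ → ℝ → ℝ),
    MemW1q q u₀ du₀ ∧ MemLqW1qModConst q u₁ du₁ ∧
    -- `u_n ⇀ u₀` in `W^{1,q}(𝕋)`
    WeakLq q us u₀ ∧ WeakLq q (fun n => deriv (us n)) du₀ ∧
    WeakTwoScale q ε (fun n => deriv (us n)) (fun x y => du₀ x + du₁ x y)) ∧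
  Tendsto (fun n => eLpNorm (fun x => us n x - u₀ x) ⊤ cell) atTop (𝓝 0) ∧
  WeakTwoScale 1 ε ms m ∧
  WeakLq 1 ms (fun x => ∫ y in (0 : ℝ)..1, m x y) ∧
  Tendsto Hs atTop (𝓝 H) ∧
  (∀ x ∈ Icc (0 : ℝ) 1, Tendsto (fun n => current P (us n) (ms n) x) atTop (𝓝 j))

/-- `F(t) = j²/(2t²) - ln t`, for `t > 0`. -/
def F (j t : ℝ) : ℝ := j ^ 2 / (2 * t ^ 2) - Real.log t

theorem F_strictAntiOn (j : ℝ) : StrictAntiOn (F j) (Ioi 0) := by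
  intro a ha b hb hab
  have ha' : (0 : ℝ) < a := ha
  have h1 : Real.log a < Real.log b := Real.log_lt_log ha' hab
  have h2 : j ^ 2 / (2 * b ^ 2) ≤ j ^ 2 / (2 * a ^ 2) := by
    gcongr
  unfold F
  linarith

/-- `F` is a bijection of `(0,∞)` onto `ℝ`, so that `F⁻¹ : ℝ → (0,∞)` is defined everywhere. -/
theorem F_bijOn (j : ℝ) : BijOn (F j) (Ioi 0) univ := by
  refine ⟨fun _ _ => mem_univ _, (F_strictAntiOn j).injOn, ?_⟩
  intro s _
  have hcont : ContinuousOn (F j) (Ioi 0) := by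
    intro t ht
    have ht' : t ≠ 0 := ne_of_gt ht
    unfold F
    apply ContinuousAt.continuousWithinAt
    have := Real.continuousAt_log ht'
    have h2 : (2 : ℝ) * t ^ 2 ≠ 0 := by positivity
    fun_prop (disch := assumption)
  have ha : (0 : ℝ) < Real.exp (-s) := Real.exp_pos _
  have hb : (0 : ℝ) < Real.exp (|s| + j ^ 2 / 2) := Real.exp_pos _
  have hFa : s ≤ F j (Real.exp (-s)) := by
    unfold F
    rw [Real.log_exp]
    have : 0 ≤ j ^ 2 / (2 * Real.exp (-s) ^ 2) := by positivity
    linarith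
  have hFb : F j (Real.exp (|s| + j ^ 2 / 2)) ≤ s := by
    unfold F
    rw [Real.log_exp]
    have h1 : 1 ≤ Real.exp (|s| + j ^ 2 / 2) := Real.one_le_exp (by positivity)
    have h2 : j ^ 2 / (2 * Real.exp (|s| + j ^ 2 / 2) ^ 2) ≤ j ^ 2 / 2 := by
      apply div_le_div_of_nonneg_left (by positivity) (by norm_num)
      nlinarith
    linarith [neg_abs_le s]
  exact (convex_Ioi (0 : ℝ)).isPreconnected.intermediate_value hb ha hcont ⟨hFb, hFa⟩

/-- `F⁻¹ : ℝ → (0,∞)`. -/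
def Finv (j : ℝ) : ℝ → ℝ := Function.invFunOn (F j) (Ioi 0)

end PeriodicMFG

end

noncomputable section

namespace PeriodicMFG

/-! ### The unit cell -/

/-! The constant current eliminates `u`: since `P + u_x = j_ε / m_ε`, the Hamilton-Jacobi equation
becomes the pointwise algebraic relation `F_{j_ε}(m_ε(x)) = H_ε - V(x, x/ε)` (`IsMFGSolution.F_m`).
The function `F_j` is `-log` plus a decreasing term, so it expands logarithmic distances
(`abs_log_sub_log_le_abs_F_sub`) and `log ∘ F_j⁻¹` is 1-Lipschitz.

Compactness is therefore needed only for two scalars. The mass constraint gives a point where `m_ε =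
1`, which bounds `log m_ε` and, together with Rolle's theorem for `u_ε`, bounds `j_ε` and `H_ε`.
Once `H_ε → H` and `j_ε → j`, the density `m_ε` is uniformly close to the oscillating function
`F_j⁻¹(H - V(x, x/ε))`, and `(u_ε)_x = j_ε / m_ε - P` is close to the corresponding profile
(`isAsymptoticProfile_log` and its corollaries).

All the convergences then follow from averaging of `G(x, x/ε)` for continuous `G` periodic in `y`
(`exists_abs_integral_oscillating_sub_le`). Conversely, any other limit along the same subsequence
has the same `H` and `j`, hence the same profiles; uniqueness of two-scale limits
(`WeakTwoScale.ae_eq`) identifies `m` and `(u₀)_x + (u₁)_y`. The formula for `j` expresses that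
`(u_ε)_x` has mean zero. -/

instance : IsProbabilityMeasure cell := ⟨by simp [cell]⟩

instance : IsProbabilityMeasure cell2 := by unfold cell2; infer_instance

theorem integral_cell (f : ℝ → ℝ) : ∫ x, f x ∂cell = ∫ x in (0 : ℝ)..1, f x := by
  rw [intervalIntegral.integral_of_le zero_le_one, cell]

theorem integral_cell2 {f : ℝ → ℝ → ℝ} (hf : Integrable (fun z : ℝ × ℝ => f z.1 z.2) cell2) :
    ∫ z, f z.1 z.2 ∂cell2 = ∫ x in (0 : ℝ)..1, ∫ y in (0 : ℝ)..1, f x y := by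
  unfold cell2 at hf ⊢
  rw [integral_prod _ hf, ← integral_cell]
  simp only [integral_cell]

theorem ae_cell_mem : ∀ᵐ x ∂cell, x ∈ Ioc (0 : ℝ) 1 := ae_restrict_mem measurableSet_Ioc

theorem memLp_cell_of_continuous {f : ℝ → ℝ} (hf : Continuous f) (p : ℝ≥0∞) :
    MemLp f p cell := by
  obtain ⟨C, hC⟩ := isCompact_Icc.exists_bound_of_continuousOn (s := Icc (0 : ℝ) 1)
    hf.continuousOn
  refine MemLp.of_bound hf.aestronglyMeasurable C ?_
  filter_upwards [ae_cell_mem] with x hx using hC x (Ioc_subset_Icc_self hx)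

theorem ae_cell2_mem : ∀ᵐ z ∂cell2, z.1 ∈ Ioc (0 : ℝ) 1 ∧ z.2 ∈ Ioc (0 : ℝ) 1 :=
  (Measure.quasiMeasurePreserving_fst.ae ae_cell_mem).and
    (Measure.quasiMeasurePreserving_snd.ae ae_cell_mem)

theorem memLp_cell2_of_continuous {f : ℝ × ℝ → ℝ} (hf : Continuous f) (p : ℝ≥0∞) :
    MemLp f p cell2 := by
  obtain ⟨C, hC⟩ := (isCompact_Icc.prod isCompact_Icc).exists_bound_of_continuousOn
    (s := Icc (0 : ℝ) 1 ×ˢ Icc (0 : ℝ) 1) hf.continuousOn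
  refine MemLp.of_bound hf.aestronglyMeasurable C ?_
  filter_upwards [ae_cell2_mem] with x hx
  exact hC x ⟨Ioc_subset_Icc_self hx.1, Ioc_subset_Icc_self hx.2⟩

theorem intervalIntegral_congr_cell {f g : ℝ → ℝ} (h : f =ᵐ[cell] g) {a b : ℝ}
    (ha : a ∈ Icc (0 : ℝ) 1) (hb : b ∈ Icc (0 : ℝ) 1) :
    ∫ x in a..b, f x = ∫ x in a..b, g x := by
  apply intervalIntegral.integral_congr_ae_restrict
  apply ae_mono _ h
  apply Measure.restrict_mono _ le_rfl
  rw [uIoc]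
  exact Ioc_subset_Ioc (le_min ha.1 hb.1) (max_le ha.2 hb.2)

theorem periodic_map_fract {f : ℝ → ℝ} (hf : Function.Periodic f 1) (y : ℝ) :
    f (Int.fract y) = f y := by
  have := hf.sub_zsmul_eq (x := y) ⌊y⌋
  rwa [zsmul_one] at this

/-! ### Averaging of oscillating functions -/

theorem exists_bound_of_periodic_snd {G : ℝ → ℝ → ℝ} (hG : Continuous fun z : ℝ × ℝ => G z.1 z.2)
    (hper : ∀ x y, G x (y + 1) = G x y) (a b : ℝ) :
    ∃ B : ℝ, 0 ≤ B ∧ ∀ x ∈ Icc a b, ∀ y, |G x y| ≤ B := by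
  obtain ⟨C, hC⟩ := (isCompact_Icc.prod isCompact_Icc).exists_bound_of_continuousOn
    (s := Icc a b ×ˢ Icc (0 : ℝ) 1) hG.continuousOn
  refine ⟨max C 0, le_max_right _ _, fun x hx y => ?_⟩
  have hfr : G x y = G x (Int.fract y) :=
    (periodic_map_fract (hper x) y).symm
  rw [hfr]
  exact (hC (x, Int.fract y) ⟨hx, Int.fract_nonneg _, (Int.fract_lt_one _).le⟩).trans
    (le_max_left _ _)

theorem exists_modulus_of_periodic_snd {G : ℝ → ℝ → ℝ}
    (hG : Continuous fun z : ℝ × ℝ => G z.1 z.2)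
    (hper : ∀ x y, G x (y + 1) = G x y) (a b : ℝ) {η : ℝ} (hη : 0 < η) :
    ∃ δ > 0, ∀ x ∈ Icc a b, ∀ x' ∈ Icc a b, |x - x'| < δ → ∀ y, |G x y - G x' y| ≤ η := by
  have huc := (isCompact_Icc.prod isCompact_Icc).uniformContinuousOn_of_continuous
    (s := Icc a b ×ˢ Icc (0 : ℝ) 1) hG.continuousOn
  obtain ⟨δ, hδ, h⟩ := Metric.uniformContinuousOn_iff.1 huc η hη
  refine ⟨δ, hδ, fun x hx x' hx' hxx y => ?_⟩
  have hfr : ∀ x, G x y = G x (Int.fract y) := fun x =>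
    (periodic_map_fract (hper x) y).symm
  rw [hfr x, hfr x']
  have hy : Int.fract y ∈ Icc (0 : ℝ) 1 := ⟨Int.fract_nonneg _, (Int.fract_lt_one _).le⟩
  refine (h (x, Int.fract y) ⟨hx, hy⟩ (x', Int.fract y) ⟨hx', hy⟩ ?_).le
  simpa [Prod.dist_eq, Real.dist_eq] using max_lt hxx hδ

/-- Translating `x` by `ε s` shifts the fast variable by `s` and costs only two boundary terms and a
modulus of continuity in the slow variable. Averaging over `s ∈ [0,1]` then produces the cell mean
exactly. Uniformity in the endpoint `b` is what later gives uniform convergence of primitives. -/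
theorem exists_abs_integral_oscillating_sub_le {G : ℝ → ℝ → ℝ}
    (hG : Continuous fun z : ℝ × ℝ => G z.1 z.2)
    (hper : ∀ x y, G x (y + 1) = G x y) {η : ℝ} (hη : 0 < η) :
    ∃ δ > 0, ∀ ε : ℝ, 0 < ε → ε < δ → ∀ b ∈ Icc (0 : ℝ) 1,
      |(∫ x in (0 : ℝ)..b, G x (x / ε)) - ∫ x in (0 : ℝ)..b, ∫ y in (0 : ℝ)..1, G x y| ≤ η := by
  -- The window `[0,2]` contains the translated points `x + ε s`, as `ε < 1`.
  obtain ⟨B, hB0, hB⟩ := exists_bound_of_periodic_snd hG hper 0 2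
  obtain ⟨δ, hδ, hmod⟩ := exists_modulus_of_periodic_snd hG hper 0 2 (half_pos hη)
  refine ⟨min (min δ 1) (η / (4 * (B + 1))), by positivity, fun ε hε hεδ b hb => ?_⟩
  have hε1 : ε < δ := hεδ.trans_le ((min_le_left _ _).trans (min_le_left _ _))
  have hε2 : ε < 1 := hεδ.trans_le ((min_le_left _ _).trans (min_le_right _ _))
  have hε3 : 2 * B * ε ≤ η / 2 := by
    have : ε ≤ η / (4 * (B + 1)) := hεδ.le.trans (min_le_right _ _)
    rw [le_div_iff₀ (by positivity)] at this
    nlinarith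
  have hGc : ∀ {f g : ℝ × ℝ → ℝ}, Continuous f → Continuous g →
      Continuous fun z => G (f z) (g z) := fun hf hg => hG.comp (hf.prodMk hg)
  have hGc1 : ∀ {f g : ℝ → ℝ}, Continuous f → Continuous g →
      Continuous fun z => G (f z) (g z) := fun hf hg => hG.comp (hf.prodMk hg)
  have hint : ∀ {f : ℝ → ℝ}, Continuous f → ∀ a b : ℝ, IntervalIntegrable f volume a b :=
    fun hf a b => hf.intervalIntegrable a b
  have hf : Continuous fun x => G x (x / ε) := hGc1 continuous_id (by fun_prop)
  have key : ∀ s ∈ Icc (0 : ℝ) 1,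
      |(∫ x in (0 : ℝ)..b, G x (x / ε)) - ∫ x in (0 : ℝ)..b, G x (x / ε + s)| ≤ η := by
    intro s hs
    have hεs0 : 0 ≤ ε * s := by have := hs.1; positivity
    have hεs1 : ε * s ≤ ε := by nlinarith [hs.2]
    have e1 : ∫ x in (0 : ℝ)..b, G (x + ε * s) (x / ε + s)
        = ∫ x in (0 + ε * s)..(b + ε * s), G x (x / ε) := by
      rw [← intervalIntegral.integral_comp_add_right (fun x => G x (x / ε)) (ε * s)]
      congr 1; ext x; congr 1; field_simp
    have e2 : (∫ x in (0 : ℝ)..b, G x (x / ε)) - ∫ x in (0 + ε * s)..(b + ε * s), G x (x / ε)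
        = (∫ x in (0 : ℝ)..(0 + ε * s), G x (x / ε)) - ∫ x in b..(b + ε * s), G x (x / ε) :=
      intervalIntegral.integral_interval_sub_interval_comm (hint hf _ _) (hint hf _ _)
        (hint hf _ _)
    have hsmall : ∀ c ∈ Icc (0 : ℝ) 1, |∫ x in c..(c + ε * s), G x (x / ε)| ≤ B * ε := by
      intro c hc
      have := intervalIntegral.norm_integral_le_of_norm_le_const (a := c) (b := c + ε * s)
        (f := fun x => G x (x / ε)) (C := B) (fun x hx => by
          rw [uIoc_of_le (by linarith)] at hx
          exact hB x ⟨by linarith [hx.1, hc.1], by linarith [hx.2, hc.2]⟩ _)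
      refine this.trans ?_
      rw [add_sub_cancel_left, abs_of_nonneg hεs0]
      gcongr
    have e3 : |(∫ x in (0 : ℝ)..b, G (x + ε * s) (x / ε + s))
        - ∫ x in (0 : ℝ)..b, G x (x / ε + s)| ≤ η / 2 := by
      rw [← intervalIntegral.integral_sub (hint (hGc1 (by fun_prop) (by fun_prop)) _ _)
        (hint (hGc1 (by fun_prop) (by fun_prop)) _ _)]
      have := intervalIntegral.norm_integral_le_of_norm_le_const (a := 0) (b := b)
        (f := fun x => G (x + ε * s) (x / ε + s) - G x (x / ε + s)) (C := η / 2) (fun x hx => by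
          rw [uIoc_of_le hb.1] at hx
          refine hmod _ ⟨by linarith [hx.1], by linarith [hx.2, hb.2]⟩ _
            ⟨by linarith [hx.1], by linarith [hx.2, hb.2]⟩ ?_ _
          rw [add_sub_cancel_left, abs_of_nonneg hεs0]; linarith)
      refine this.trans ?_
      rw [sub_zero, abs_of_nonneg hb.1]
      nlinarith [hb.2]
    have h0 := hsmall 0 ⟨le_rfl, zero_le_one⟩
    have h1 := hsmall b hb
    rw [e1] at e3
    rw [abs_le] at *
    constructor <;> linarith [h0.1, h0.2, h1.1, h1.2, e3.1, e3.2]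
  -- For fixed `x`, the variable `x / ε + s` sweeps one full period as `s` runs over `[0,1]`.
  have hswap : ∫ x in (0 : ℝ)..b, ∫ y in (0 : ℝ)..1, G x y
      = ∫ s in (0 : ℝ)..1, ∫ x in (0 : ℝ)..b, G x (x / ε + s) := by
    rw [intervalIntegral_intervalIntegral_swap
      (F := fun s x => G x (x / ε + s))]
    · congr 1; ext x
      have hp : Function.Periodic (G x) 1 := hper x
      have := hp.intervalIntegral_add_eq (x / ε) 0
      rw [zero_add] at this
      rw [← this, intervalIntegral.integral_comp_add_left (fun y => G x y), add_zero]
    · refine ((hGc (f := fun z => z.2) (g := fun z => z.2 / ε + z.1) (by fun_prop)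
        (by fun_prop)).continuousOn.integrableOn_compact
        (isCompact_uIcc.prod isCompact_uIcc)).mono_set
        (prod_mono uIoc_subset_uIcc uIoc_subset_uIcc)
  have hinner : Continuous fun s => ∫ x in (0 : ℝ)..b, G x (x / ε + s) :=
    intervalIntegral.continuous_parametric_intervalIntegral_of_continuous'
      (hGc (f := fun z => z.2) (g := fun z => z.2 / ε + z.1) (by fun_prop) (by fun_prop)) _ _
  have hconst : ∫ x in (0 : ℝ)..b, G x (x / ε)
      = ∫ _s in (0 : ℝ)..1, ∫ x in (0 : ℝ)..b, G x (x / ε) := by simp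
  rw [hswap, hconst, ← intervalIntegral.integral_sub (hint continuous_const _ _) (hint hinner _ _)]
  have := intervalIntegral.norm_integral_le_of_norm_le_const (a := 0) (b := 1)
    (f := fun s => (∫ x in (0 : ℝ)..b, G x (x / ε)) - ∫ x in (0 : ℝ)..b, G x (x / ε + s)) (C := η)
    (fun s hs => by
      rw [uIoc_of_le zero_le_one] at hs
      exact key s (Ioc_subset_Icc_self hs))
  simpa using this

/-- The continuous functions `w n` are uniformly asymptotic on `[0,1]` to the oscillating profiles
`x ↦ G x (x / ε n)`, with `G` continuous and `1`-periodic in its second variable. -/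
structure IsAsymptoticProfile (ε : ℕ → ℝ) (w : ℕ → ℝ → ℝ) (G : ℝ → ℝ → ℝ) : Prop where
  continuous_seq : ∀ n, Continuous (w n)
  continuous_profile : Continuous fun z : ℝ × ℝ => G z.1 z.2
  periodic : ∀ x y, G x (y + 1) = G x y
  close : ∀ η > 0, ∀ᶠ n in atTop, ∀ x ∈ Icc (0 : ℝ) 1, |w n x - G x (x / ε n)| ≤ η

theorem continuous_mean {G : ℝ → ℝ → ℝ} (hG : Continuous fun z : ℝ × ℝ => G z.1 z.2) :
    Continuous fun x => ∫ y in (0 : ℝ)..1, G x y :=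
  intervalIntegral.continuous_parametric_intervalIntegral_of_continuous' hG _ _

theorem continuous_slice {G : ℝ → ℝ → ℝ} (hG : Continuous fun z : ℝ × ℝ => G z.1 z.2)
    (x : ℝ) : Continuous (G x) := hG.comp (by fun_prop : Continuous fun y : ℝ => (x, y))

/-! ### Calculus and averaging of asymptotic profiles -/

namespace IsAsymptoticProfile

variable {ε : ℕ → ℝ} {w : ℕ → ℝ → ℝ} {G : ℝ → ℝ → ℝ}

theorem self {G : ℝ → ℝ → ℝ} (hG : Continuous fun z : ℝ × ℝ => G z.1 z.2)
    (hper : ∀ x y, G x (y + 1) = G x y) (ε : ℕ → ℝ) :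
    IsAsymptoticProfile ε (fun n x => G x (x / ε n)) G where
  continuous_seq n := hG.comp (by fun_prop : Continuous fun x : ℝ => (x, x / ε n))
  continuous_profile := hG
  periodic := hper
  close η hη := by simp [hη.le]

theorem exists_bound (h : IsAsymptoticProfile ε w G) :
    ∃ B > 0, (∀ x ∈ Icc (0 : ℝ) 1, ∀ y, |G x y| ≤ B) ∧
      ∀ᶠ n in atTop, ∀ x ∈ Icc (0 : ℝ) 1, |w n x| ≤ B := by
  obtain ⟨B, hB0, hB⟩ := exists_bound_of_periodic_snd h.continuous_profile h.periodic 0 1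
  refine ⟨B + 1, by linarith, fun x hx y => (hB x hx y).trans (by linarith), ?_⟩
  filter_upwards [h.close 1 one_pos] with n hn x hx
  have h1 := abs_le.1 (hn x hx)
  have h2 := abs_le.1 (hB x hx (x / ε n))
  exact abs_le.2 ⟨by linarith [h1.1, h2.1], by linarith [h1.2, h2.2]⟩

theorem comp (h : IsAsymptoticProfile ε w G) {Φ : ℝ → ℝ} (hΦ : Continuous Φ) :
    IsAsymptoticProfile ε (fun n x => Φ (w n x)) (fun x y => Φ (G x y)) where
  continuous_seq n := hΦ.comp (h.continuous_seq n)
  continuous_profile := hΦ.comp h.continuous_profile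
  periodic x y := by rw [h.periodic]
  close η hη := by
    obtain ⟨B, -, hB, hB'⟩ := h.exists_bound
    obtain ⟨δ, hδ, hΦδ⟩ := Metric.uniformContinuousOn_iff.1
      (isCompact_Icc.uniformContinuousOn_of_continuous (s := Icc (-B) B) hΦ.continuousOn) η hη
    filter_upwards [hB', h.close (δ / 2) (half_pos hδ)] with n hn hc x hx
    refine (hΦδ _ (abs_le.1 (hn x hx)) _ (abs_le.1 (hB x hx _)) ?_).le
    rw [Real.dist_eq]
    linarith [hc x hx]

theorem mul (h : IsAsymptoticProfile ε w G) {v : ℕ → ℝ → ℝ} {K : ℝ → ℝ → ℝ}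
    (k : IsAsymptoticProfile ε v K) :
    IsAsymptoticProfile ε (fun n x => w n x * v n x) (fun x y => G x y * K x y) where
  continuous_seq n := (h.continuous_seq n).mul (k.continuous_seq n)
  continuous_profile := h.continuous_profile.mul k.continuous_profile
  periodic x y := by rw [h.periodic, k.periodic]
  close η hη := by
    obtain ⟨B, hB0, hB, hB'⟩ := h.exists_bound
    obtain ⟨C, hC0, hC, hC'⟩ := k.exists_bound
    filter_upwards [h.close (η / (2 * C)) (by positivity), k.close (η / (2 * B)) (by positivity),
      hC'] with n h1 h2 h3 x hx
    have e : w n x * v n x - G x (x / ε n) * K x (x / ε n)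
        = (w n x - G x (x / ε n)) * v n x + G x (x / ε n) * (v n x - K x (x / ε n)) := by ring
    rw [e]
    calc _ ≤ |w n x - G x (x / ε n)| * |v n x| + |G x (x / ε n)| * |v n x - K x (x / ε n)| := by
          rw [← abs_mul, ← abs_mul]; exact abs_add_le _ _
      _ ≤ η / (2 * C) * C + B * (η / (2 * B)) := by
          gcongr
          exacts [h1 x hx, h3 x hx, hB x hx _, h2 x hx]
      _ = η := by field_simp; ring

theorem const_mul (h : IsAsymptoticProfile ε w G) {c : ℕ → ℝ} {c₀ : ℝ}
    (hc : Tendsto c atTop (𝓝 c₀)) :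
    IsAsymptoticProfile ε (fun n x => c n * w n x) (fun x y => c₀ * G x y) :=
  mul (w := fun n _ => c n) (G := fun _ _ => c₀)
    { continuous_seq := fun _ => continuous_const
      continuous_profile := continuous_const
      periodic := fun _ _ => rfl
      close := fun η hη => by
        filter_upwards [(Metric.tendsto_nhds.1 hc) η hη] with n hn x _
        exact hn.le } h

theorem congr (h : IsAsymptoticProfile ε w G) {v : ℕ → ℝ → ℝ} (hv : ∀ n, Continuous (v n))
    (hvw : ∀ n, ∀ x ∈ Icc (0 : ℝ) 1, v n x = w n x) : IsAsymptoticProfile ε v G where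
  continuous_seq := hv
  continuous_profile := h.continuous_profile
  periodic := h.periodic
  close η hη := by
    filter_upwards [h.close η hη] with n hn x hx
    rw [hvw n x hx]; exact hn x hx

theorem integral_close (h : IsAsymptoticProfile ε w G) (hpos : ∀ n, 0 < ε n)
    (hε : Tendsto ε atTop (𝓝 0)) {η : ℝ} (hη : 0 < η) :
    ∀ᶠ n in atTop, ∀ b ∈ Icc (0 : ℝ) 1,
      |(∫ x in (0 : ℝ)..b, w n x) - ∫ x in (0 : ℝ)..b, ∫ y in (0 : ℝ)..1, G x y| ≤ η := by
  obtain ⟨δ, hδ, hb⟩ := exists_abs_integral_oscillating_sub_le h.continuous_profile h.periodic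
    (half_pos hη)
  filter_upwards [h.close (η / 2) (half_pos hη), hε.eventually (gt_mem_nhds hδ)] with n h1 h2 b hb1
  have hs := (self h.continuous_profile h.periodic ε).continuous_seq n
  have e1 : |(∫ x in (0 : ℝ)..b, w n x) - ∫ x in (0 : ℝ)..b, G x (x / ε n)| ≤ η / 2 := by
    rw [← intervalIntegral.integral_sub ((h.continuous_seq n).intervalIntegrable _ _)
      (hs.intervalIntegrable _ _)]
    have := intervalIntegral.norm_integral_le_of_norm_le_const (a := 0) (b := b)
      (f := fun x => w n x - G x (x / ε n)) (C := η / 2) (fun x hx => by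
        rw [uIoc_of_le hb1.1] at hx
        exact h1 x ⟨hx.1.le, hx.2.trans hb1.2⟩)
    refine this.trans ?_
    rw [sub_zero, abs_of_nonneg hb1.1]
    nlinarith [hb1.2]
  have e2 := hb (ε n) (hpos n) h2 b hb1
  rw [abs_le] at *
  constructor <;> linarith [e1.1, e1.2, e2.1, e2.2]

theorem tendsto_integral (h : IsAsymptoticProfile ε w G) (hpos : ∀ n, 0 < ε n)
    (hε : Tendsto ε atTop (𝓝 0)) :
    Tendsto (fun n => ∫ x in (0 : ℝ)..1, w n x) atTop
      (𝓝 (∫ x in (0 : ℝ)..1, ∫ y in (0 : ℝ)..1, G x y)) := by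
  rw [Metric.tendsto_nhds]
  intro η hη
  filter_upwards [h.integral_close hpos hε (half_pos hη)] with n hn
  have := hn 1 ⟨zero_le_one, le_rfl⟩
  rw [Real.dist_eq]; linarith

/-- The sequence is eventually uniformly bounded, so `g` may be replaced by an `L¹`-close continuous
`k`. The function `k` need not be periodic: profiles are periodic only in the fast variable. -/
theorem tendsto_integral_mul (h : IsAsymptoticProfile ε w G) (hpos : ∀ n, 0 < ε n)
    (hε : Tendsto ε atTop (𝓝 0)) {g : ℝ → ℝ} (hg : Integrable g cell) :
    Tendsto (fun n => ∫ x in (0 : ℝ)..1, w n x * g x) atTop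
      (𝓝 (∫ x in (0 : ℝ)..1, (∫ y in (0 : ℝ)..1, G x y) * g x)) := by
  obtain ⟨B, hB0, hB, hB'⟩ := h.exists_bound
  rw [Metric.tendsto_nhds]
  intro η hη
  obtain ⟨k, -, hk, hkc, hki⟩ := hg.exists_hasCompactSupport_integral_sub_le
    (ε := η / (4 * B)) (by positivity)
  have hprof : IsAsymptoticProfile ε (fun n x => w n x * k x) (fun x y => G x y * k x) :=
    h.mul (self (G := fun x _ => k x) (by fun_prop) (fun _ _ => rfl) ε)
  have hmean := continuous_mean h.continuous_profile
  have approx : ∀ f : ℝ → ℝ, Continuous f → (∀ x ∈ Icc (0 : ℝ) 1, |f x| ≤ B) →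
      |(∫ x in (0 : ℝ)..1, f x * g x) - ∫ x in (0 : ℝ)..1, f x * k x| ≤ η / 4 := by
    intro f hf hfB
    have hfb : ∀ᵐ x ∂cell, ‖f x‖ ≤ B := by
      filter_upwards [ae_cell_mem] with x hx using hfB x (Ioc_subset_Icc_self hx)
    rw [← integral_cell, ← integral_cell, ← integral_sub
      (hg.bdd_mul hf.aestronglyMeasurable hfb) (hki.bdd_mul hf.aestronglyMeasurable hfb)]
    calc |∫ x, f x * g x - f x * k x ∂cell| ≤ ∫ x, B * ‖g x - k x‖ ∂cell := by
          rw [← Real.norm_eq_abs]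
          refine MeasureTheory.norm_integral_le_of_norm_le ((hg.sub hki).norm.const_mul B) ?_
          filter_upwards [hfb] with x hx
          rw [← mul_sub, norm_mul]
          gcongr
      _ ≤ B * (η / (4 * B)) := by
          rw [integral_const_mul]; gcongr
      _ = η / 4 := by field_simp
  have hmB : ∀ x ∈ Icc (0 : ℝ) 1, |∫ y in (0 : ℝ)..1, G x y| ≤ B := by
    intro x hx
    simpa using intervalIntegral.norm_integral_le_of_norm_le_const (a := 0) (b := 1)
      (f := G x) (C := B) fun y _ => hB x hx y
  have e2 := approx _ hmean hmB
  filter_upwards [hB', (Metric.tendsto_nhds.1 (hprof.tendsto_integral hpos hε)) (η / 4)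
    (by positivity)] with n hn h3
  have e1 := approx _ (h.continuous_seq n) hn
  simp only [intervalIntegral.integral_mul_const] at h3
  rw [Real.dist_eq] at *
  rw [abs_lt] at *
  rw [abs_le] at e1 e2
  constructor <;> linarith [e1.1, e1.2, e2.1, e2.2, h3.1, h3.2]

theorem weakTwoScale (h : IsAsymptoticProfile ε w G) (hpos : ∀ n, 0 < ε n)
    (hε : Tendsto ε atTop (𝓝 0)) (q : ℝ≥0∞) : WeakTwoScale q ε w G :=
  ⟨fun n => memLp_cell_of_continuous (h.continuous_seq n) q,
    memLp_cell2_of_continuous h.continuous_profile q,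
    fun _ hψ => (h.mul (self hψ.1.continuous hψ.2.2 ε)).tendsto_integral hpos hε⟩

theorem weakLq (h : IsAsymptoticProfile ε w G) (hpos : ∀ n, 0 < ε n)
    (hε : Tendsto ε atTop (𝓝 0)) (q : ℝ≥0∞) :
    WeakLq q w (fun x => ∫ y in (0 : ℝ)..1, G x y) := by
  refine ⟨fun n => memLp_cell_of_continuous (h.continuous_seq n) q,
    memLp_cell_of_continuous (continuous_mean h.continuous_profile) q, fun q' hq' g hg => ?_⟩
  have := hq'
  exact h.tendsto_integral_mul hpos hε (hg.integrable (ENNReal.HolderConjugate.one_le q' q))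

/-- The power `|w n|ᵖ` again has a continuous profile, `|G|ᵖ`, so averaging yields the norms
themselves. -/
theorem tendsto_eLpNorm (h : IsAsymptoticProfile ε w G) (hpos : ∀ n, 0 < ε n)
    (hε : Tendsto ε atTop (𝓝 0)) {p : ℝ≥0∞} (hp1 : 1 ≤ p) (hp : p ≠ ⊤) :
    Tendsto (fun n => eLpNorm (w n) p cell) atTop
      (𝓝 (eLpNorm (fun z : ℝ × ℝ => G z.1 z.2) p cell2)) := by
  have hp0 : p ≠ 0 := (one_pos.trans_le hp1).ne'
  have hpr : 0 < p.toReal := ENNReal.toReal_pos hp0 hp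
  have hprof := h.comp (Φ := fun t => ‖t‖ ^ p.toReal)
    (continuous_norm.rpow_const fun _ => Or.inr hpr.le)
  have ht := hprof.tendsto_integral hpos hε
  rw [(memLp_cell2_of_continuous h.continuous_profile p).eLpNorm_eq_integral_rpow_norm hp0 hp,
    integral_cell2 (f := fun x y => ‖G x y‖ ^ p.toReal)
      ((memLp_cell2_of_continuous hprof.continuous_profile 1).integrable le_rfl)]
  simp_rw [fun n => (memLp_cell_of_continuous (h.continuous_seq n) p).eLpNorm_eq_integral_rpow_norm
    hp0 hp, integral_cell]
  exact (ENNReal.continuous_ofReal.tendsto _).comp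
    (ht.rpow_const (Or.inr (inv_nonneg.2 hpr.le)))

end IsAsymptoticProfile

/-! ### Periodic test functions -/

theorem eventually_fract_of_fract_eq_zero {x : ℝ} (hx : Int.fract x = 0) {δ : ℝ} (hδ : 0 < δ) :
    ∀ᶠ x' in 𝓝 x, Int.fract x' < δ ∨ 1 - δ < Int.fract x' := by
  have hxn : (⌊x⌋ : ℝ) = x := by have := Int.floor_add_fract x; linarith
  filter_upwards [Ioo_mem_nhds (show x - min δ 1 < x by simp [hδ])
    (show x < x + min δ 1 by simp [hδ])] with y hy
  have h1 := min_le_left δ 1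
  have h2 := min_le_right δ 1
  rcases le_or_gt x y with h | h
  · left
    have : ⌊y⌋ = ⌊x⌋ := Int.floor_eq_iff.2 ⟨by linarith, by linarith [hy.2]⟩
    rw [Int.fract, this]
    linarith [hy.2]
  · right
    have : ⌊y⌋ = ⌊x⌋ - 1 := Int.floor_eq_iff.2
      ⟨by push_cast; linarith [hy.1], by push_cast; linarith⟩
    rw [Int.fract, this]
    push_cast
    linarith [hy.1]

theorem eventually_floor_eq {x : ℝ} (hx : Int.fract x ≠ 0) : ∀ᶠ x' in 𝓝 x, ⌊x'⌋ = ⌊x⌋ := by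
  have h0 : (⌊x⌋ : ℝ) < x := by
    have := Int.floor_add_fract x
    have := (Int.fract_nonneg x).lt_of_ne' hx
    linarith
  filter_upwards [Ioo_mem_nhds h0 (Int.lt_floor_add_one x)] with y hy
  exact Int.floor_eq_iff.2 ⟨hy.1.le, hy.2⟩

/-- The support keeps a distance `δ` from the sides of the square. Hence the periodization vanishes
near the lines where `Int.fract` jumps, and elsewhere it is locally an integer translate of `g`. -/
theorem smoothPeriodic2_fract {g : ℝ × ℝ → ℝ} (hg : ContDiff ℝ ∞ g) (hc : HasCompactSupport g)
    (hs : tsupport g ⊆ Ioo (0 : ℝ) 1 ×ˢ Ioo (0 : ℝ) 1) :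
    SmoothPeriodic2 fun x y => g (Int.fract x, Int.fract y) := by
  refine ⟨?_, fun x y => by simp, fun x y => by simp⟩
  obtain ⟨δ, hδ, hδs⟩ : ∃ δ > 0, ∀ z, g z ≠ 0 →
      δ ≤ z.1 ∧ z.1 ≤ 1 - δ ∧ δ ≤ z.2 ∧ z.2 ≤ 1 - δ := by
    obtain ⟨δ, hδ, h⟩ := IsCompact.exists_forall_le' (s := tsupport g) hc
      (f := fun z : ℝ × ℝ => min (min z.1 (1 - z.1)) (min z.2 (1 - z.2))) (a := 0)
      (by fun_prop) (fun z hz => by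
        obtain ⟨h1, h2⟩ := hs hz
        have := h1.1; have := h1.2; have := h2.1; have := h2.2
        simp_all)
    refine ⟨δ, hδ, fun z hz => ?_⟩
    have := h z (subset_tsupport g hz)
    simp only [le_min_iff] at this
    obtain ⟨⟨a, b⟩, c, d⟩ := this
    exact ⟨a, by linarith, c, by linarith⟩
  rw [contDiff_iff_contDiffAt]
  rintro ⟨x, y⟩
  have hfst : Tendsto (fun z : ℝ × ℝ => z.1) (𝓝 (x, y)) (𝓝 x) := continuous_fst.tendsto _
  have hsnd : Tendsto (fun z : ℝ × ℝ => z.2) (𝓝 (x, y)) (𝓝 y) := continuous_snd.tendsto _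
  by_cases hx : Int.fract x = 0
  · refine (contDiffAt_const (c := (0 : ℝ))).congr_of_eventuallyEq ?_
    filter_upwards [hfst.eventually (eventually_fract_of_fract_eq_zero hx hδ)] with z hz
    by_contra hne
    obtain ⟨h1, h2, -, -⟩ := hδs _ hne
    rcases hz with hz | hz <;> simp only at h1 h2 <;> linarith
  by_cases hy : Int.fract y = 0
  · refine (contDiffAt_const (c := (0 : ℝ))).congr_of_eventuallyEq ?_
    filter_upwards [hsnd.eventually (eventually_fract_of_fract_eq_zero hy hδ)] with z hz
    by_contra hne
    obtain ⟨-, -, h1, h2⟩ := hδs _ hne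
    rcases hz with hz | hz <;> simp only at h1 h2 <;> linarith
  · have : ContDiff ℝ ∞ fun z : ℝ × ℝ => g (z.1 - ⌊x⌋, z.2 - ⌊y⌋) := hg.comp (by fun_prop)
    refine this.contDiffAt.congr_of_eventuallyEq ?_
    filter_upwards [hfst.eventually (eventually_floor_eq hx),
      hsnd.eventually (eventually_floor_eq hy)] with z h1 h2
    simp only [Int.fract, h1, h2]

theorem cell2_eq_restrict_Ioo :
    cell2 = volume.restrict (Ioo (0 : ℝ) 1 ×ˢ Ioo (0 : ℝ) 1) := by
  rw [cell2, cell, restrict_Ioo_eq_restrict_Ioc.symm, Measure.prod_restrict,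
    Measure.volume_eq_prod]

theorem ae_cell2_eq_zero_of_integral_eq_zero {f : ℝ → ℝ → ℝ}
    (hf : Integrable (fun z : ℝ × ℝ => f z.1 z.2) cell2)
    (h : ∀ ψ, SmoothPeriodic2 ψ → ∫ x in (0 : ℝ)..1, ∫ y in (0 : ℝ)..1, f x y * ψ x y = 0) :
    ∀ᵐ z ∂cell2, f z.1 z.2 = 0 := by
  have hU : IsOpen (Ioo (0 : ℝ) 1 ×ˢ Ioo (0 : ℝ) 1) := isOpen_Ioo.prod isOpen_Ioo
  rw [cell2_eq_restrict_Ioo, ae_restrict_iff' hU.measurableSet]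
  have hloc : IntegrableOn (fun z : ℝ × ℝ => f z.1 z.2) (Ioo (0 : ℝ) 1 ×ˢ Ioo (0 : ℝ) 1) := by
    rwa [IntegrableOn, ← cell2_eq_restrict_Ioo]
  refine hU.ae_eq_zero_of_integral_contDiff_smul_eq_zero hloc.locallyIntegrableOn
    fun g hg hc hs => ?_
  have hψ := smoothPeriodic2_fract hg hc hs
  have hmem : ∀ᵐ z ∂cell2, z ∈ Ioo (0 : ℝ) 1 ×ˢ Ioo (0 : ℝ) 1 := by
    rw [cell2_eq_restrict_Ioo]; exact ae_restrict_mem hU.measurableSet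
  obtain ⟨C, hC⟩ := hc.exists_bound_of_continuous hg.continuous
  have hint : Integrable (fun z : ℝ × ℝ => f z.1 z.2 * g (Int.fract z.1, Int.fract z.2)) cell2 :=
    hf.mul_bdd (c := C) hψ.1.continuous.aestronglyMeasurable (ae_of_all _ fun z => hC _)
  rw [← h _ hψ, ← integral_cell2 hint, ← setIntegral_eq_integral_of_forall_compl_eq_zero
    (s := Ioo (0 : ℝ) 1 ×ˢ Ioo (0 : ℝ) 1), ← cell2_eq_restrict_Ioo]
  · refine integral_congr_ae ?_
    filter_upwards [hmem] with z hz
    rw [Int.fract_eq_self.2 ⟨hz.1.1.le, hz.1.2⟩, Int.fract_eq_self.2 ⟨hz.2.1.le, hz.2.2⟩,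
      smul_eq_mul, mul_comm]
  · intro z hz
    rw [image_eq_zero_of_notMem_tsupport fun hz' => hz (hs hz'), zero_smul]

/-- Reduction to two variables: `f` is regarded as a function of the second one, and a single good
`x` is kept. -/
theorem ae_cell_eq_zero_of_integral_eq_zero {f : ℝ → ℝ} (hf : Integrable f cell)
    (h : ∀ ψ, SmoothPeriodic ψ → ∫ x in (0 : ℝ)..1, f x * ψ x = 0) : ∀ᵐ x ∂cell, f x = 0 := by
  have := ae_cell2_eq_zero_of_integral_eq_zero (f := fun _ y => f y) (hf.comp_snd cell)
    fun ψ hψ => by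
      have : ∀ x, ∫ y in (0 : ℝ)..1, f y * ψ x y = 0 := fun x =>
        h _ ⟨hψ.1.comp (by fun_prop : ContDiff ℝ ∞ fun y : ℝ => (x, y)), hψ.2.2 x⟩
      simp [this]
  obtain ⟨x, hx⟩ := (Measure.ae_ae_of_ae_prod this).exists
  exact hx

theorem WeakTwoScale.ae_eq {q : ℝ≥0∞} (hq : 1 ≤ q) {ε : ℕ → ℝ} {w : ℕ → ℝ → ℝ} {f g : ℝ → ℝ → ℝ}
    (hf : WeakTwoScale q ε w f) (hg : WeakTwoScale q ε w g) :
    ∀ᵐ z ∂cell2, f z.1 z.2 = g z.1 z.2 := by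
  have hfi := hf.2.1.integrable hq
  have hgi := hg.2.1.integrable hq
  have := ae_cell2_eq_zero_of_integral_eq_zero (f := fun x y => f x y - g x y) (hfi.sub hgi)
    fun ψ hψ => by
      have hψb := memLp_cell2_of_continuous hψ.1.continuous ⊤
      have h1 : Integrable (fun z : ℝ × ℝ => f z.1 z.2 * ψ z.1 z.2) cell2 := hfi.mul_of_top_left hψb
      have h2 : Integrable (fun z : ℝ × ℝ => g z.1 z.2 * ψ z.1 z.2) cell2 := hgi.mul_of_top_left hψb
      have e := tendsto_nhds_unique (hf.2.2 ψ hψ) (hg.2.2 ψ hψ)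
      rw [← integral_cell2 h1, ← integral_cell2 h2] at e
      simp_rw [sub_mul]
      rw [← integral_cell2 (f := fun x y => f x y * ψ x y - g x y * ψ x y) (h1.sub h2),
        integral_sub h1 h2, e, sub_self]
  filter_upwards [this] with z hz using sub_eq_zero.1 hz

/-! ### Weak derivatives of periodic functions -/

theorem continuous_primitive {g : ℝ → ℝ} (hg : Continuous g) :
    Continuous fun y => ∫ s in (0 : ℝ)..y, g s :=
  intervalIntegral.continuous_primitive (fun _ _ => hg.intervalIntegrable _ _) 0

theorem hasDerivAt_primitive {g : ℝ → ℝ} (hg : Continuous g) (x : ℝ) :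
    HasDerivAt (fun y => ∫ s in (0 : ℝ)..y, g s) (g x) x :=
  intervalIntegral.integral_hasDerivAt_right (hg.intervalIntegrable _ _)
    (hg.stronglyMeasurableAtFilter _ _) hg.continuousAt

theorem periodic_primitive {g : ℝ → ℝ} (hg : Continuous g) (hper : Function.Periodic g 1)
    (h0 : ∫ s in (0 : ℝ)..1, g s = 0) : Function.Periodic (fun y => ∫ s in (0 : ℝ)..y, g s) 1 := by
  intro y
  have h := hper.intervalIntegral_add_eq y 0
  rw [zero_add, h0] at h
  have := intervalIntegral.integral_add_adjacent_intervals (hg.intervalIntegrable (μ := volume) 0 y)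
    (hg.intervalIntegrable y (y + 1))
  simp only
  linarith

theorem isWeakDeriv_of_hasDerivAt {v dv : ℝ → ℝ} (hv : ∀ x, HasDerivAt v (dv x) x)
    (hdv : Continuous dv) (hper : v 1 = v 0) : IsWeakDeriv v dv := by
  intro φ hφ
  have hφd : ∀ x, HasDerivAt φ (deriv φ x) x := fun x =>
    (hφ.1.differentiable (by simp) x).hasDerivAt
  rw [intervalIntegral.integral_mul_deriv_eq_deriv_mul (fun x _ => hv x) (fun x _ => hφd x)
    (hdv.intervalIntegrable _ _) ((hφ.1.continuous_deriv (by simp)).intervalIntegrable _ _)]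
  have : φ 1 = φ 0 := by simpa using hφ.2 0
  rw [this, hper]; ring

theorem smoothPeriodic_primitive {g : ℝ → ℝ} (hg : SmoothPeriodic g)
    (h0 : ∫ s in (0 : ℝ)..1, g s = 0) : SmoothPeriodic fun y => ∫ s in (0 : ℝ)..y, g s := by
  refine ⟨?_, periodic_primitive hg.1.continuous hg.2 h0⟩
  rw [contDiff_infty_iff_deriv]
  refine ⟨fun x => (hasDerivAt_primitive hg.1.continuous x).differentiableAt, ?_⟩
  rw [funext fun x => (hasDerivAt_primitive hg.1.continuous x).deriv]
  exact hg.1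

theorem IsWeakDeriv.integral_eq_zero {f df : ℝ → ℝ} (h : IsWeakDeriv f df) :
    ∫ x in (0 : ℝ)..1, df x = 0 := by
  simpa using (h (fun _ => 1) ⟨contDiff_const, fun _ => rfl⟩).symm

/-- Du Bois-Reymond argument: a test function minus its mean has a periodic primitive, which is an
admissible test function for the weak derivative. -/
theorem IsWeakDeriv.ae_eq_const {f : ℝ → ℝ} (h : IsWeakDeriv f 0) (hf : Integrable f cell) :
    ∀ᵐ x ∂cell, f x = ∫ y in (0 : ℝ)..1, f y := by
  set c := ∫ y in (0 : ℝ)..1, f y with hc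
  have := ae_cell_eq_zero_of_integral_eq_zero (f := fun x => f x - c)
    (hf.sub (integrable_const c)) fun ψ hψ => by
      set d := ∫ y in (0 : ℝ)..1, ψ y with hd
      have hψi := hψ.1.continuous.intervalIntegrable (μ := volume) 0 1
      have hψd : SmoothPeriodic fun x => ψ x - d :=
        ⟨hψ.1.sub contDiff_const, fun x => by simp only [hψ.2 x]⟩
      have h0 := h _ (smoothPeriodic_primitive hψd (by
        rw [intervalIntegral.integral_sub hψi (by simp)]; simp [hd]))
      simp only [funext fun x => (hasDerivAt_primitive hψd.1.continuous x).deriv, mul_sub,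
        Pi.zero_apply, zero_mul, intervalIntegral.integral_zero, neg_zero] at h0
      have hfi : IntervalIntegrable f volume 0 1 :=
        (intervalIntegrable_iff_integrableOn_Ioc_of_le zero_le_one).2 hf
      have hfψ := hfi.mul_continuousOn hψ.1.continuous.continuousOn
      rw [intervalIntegral.integral_sub hfψ (hfi.mul_const d),
        intervalIntegral.integral_mul_const, ← hc] at h0
      simp_rw [sub_mul]
      rw [intervalIntegral.integral_sub hfψ (hψi.const_mul c),
        intervalIntegral.integral_const_mul, ← hd, h0]
  filter_upwards [this] with x hx using sub_eq_zero.1 hx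

/-- Testing with the constant 1 shows that `g` has mean zero, so its primitive takes equal values at
0 and 1 and has weak derivative `g` on the torus; the difference with `f` has zero weak derivative.
-/
theorem IsWeakDeriv.ae_eq_const_add_primitive {f df g : ℝ → ℝ} (h : IsWeakDeriv f df)
    (hf : Integrable f cell) (hg : Continuous g) (hdf : df =ᵐ[cell] g) :
    (∫ x in (0 : ℝ)..1, g x = 0) ∧ ∃ c : ℝ, ∀ᵐ x ∂cell, f x = c + ∫ s in (0 : ℝ)..x, g s := by
  have h01 : (0 : ℝ) ∈ Icc (0 : ℝ) 1 := by simp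
  have h11 : (1 : ℝ) ∈ Icc (0 : ℝ) 1 := by simp
  have h0 : ∫ x in (0 : ℝ)..1, g x = 0 := by
    rw [← intervalIntegral_congr_cell hdf h01 h11, h.integral_eq_zero]
  refine ⟨h0, ?_⟩
  have hvc := continuous_primitive hg
  have hv := isWeakDeriv_of_hasDerivAt (hasDerivAt_primitive hg) hg (by simpa using h0)
  have hvi := (memLp_cell_of_continuous hvc 1).integrable le_rfl
  have hdiff : IsWeakDeriv (fun x => f x - ∫ s in (0 : ℝ)..x, g s) 0 := by
    intro φ hφ
    have hφc := hφ.1.continuous_deriv (by simp)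
    have e1 := h φ hφ
    rw [intervalIntegral_congr_cell (f := fun x => df x * φ x) (g := fun x => g x * φ x)
      (by filter_upwards [hdf] with x hx; rw [hx]) h01 h11] at e1
    have hfi : IntervalIntegrable f volume 0 1 :=
      (intervalIntegrable_iff_integrableOn_Ioc_of_le zero_le_one).2 hf
    have hvφ : IntervalIntegrable (fun x => (∫ s in (0 : ℝ)..x, g s) * deriv φ x) volume 0 1 :=
      (hvc.mul hφc).intervalIntegrable _ _
    simp_rw [sub_mul]
    rw [intervalIntegral.integral_sub (hfi.mul_continuousOn hφc.continuousOn) hvφ, e1, hv φ hφ]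
    simp
  refine ⟨∫ y in (0 : ℝ)..1, (f y - ∫ s in (0 : ℝ)..y, g s), ?_⟩
  filter_upwards [hdiff.ae_eq_const (hf.sub hvi)] with x hx
  linarith

/-! ### The function `F` and its inverse -/

theorem Finv_pos (j s : ℝ) : 0 < Finv j s :=
  Function.invFunOn_mem ((F_bijOn j).surjOn (mem_univ s))

theorem F_Finv (j s : ℝ) : F j (Finv j s) = s :=
  Function.invFunOn_eq ((F_bijOn j).surjOn (mem_univ s))

/-- Both terms of `F` are nonincreasing, so their increments have the same sign and cannot cancel.
The bound is independent of `j` and covers `j = 0`. -/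
theorem abs_log_sub_log_le_abs_F_sub (j : ℝ) {a b : ℝ} (ha : 0 < a) (hb : 0 < b) :
    |Real.log a - Real.log b| ≤ |F j a - F j b| := by
  wlog hab : a ≤ b generalizing a b
  · rw [abs_sub_comm, abs_sub_comm (F j a)]
    exact this hb ha (le_of_not_ge hab)
  have h1 : Real.log a ≤ Real.log b := Real.log_le_log ha hab
  have h2 : j ^ 2 / (2 * b ^ 2) ≤ j ^ 2 / (2 * a ^ 2) := by gcongr
  rw [abs_sub_comm, abs_of_nonneg (by linarith)]
  refine le_trans ?_ (le_abs_self _)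
  unfold F
  linarith

theorem continuous_log_Finv (j : ℝ) : Continuous fun s => Real.log (Finv j s) := by
  refine LipschitzWith.continuous (K := 1) (LipschitzWith.of_dist_le_mul fun s t => ?_)
  rw [Real.dist_eq, Real.dist_eq, NNReal.coe_one, one_mul]
  simpa only [F_Finv] using abs_log_sub_log_le_abs_F_sub j (Finv_pos j s) (Finv_pos j t)

/-- The limit density `F⁻¹(H - V(x, y))`. -/
def limitDensity (V : ℝ → ℝ → ℝ) (H j x y : ℝ) : ℝ := Finv j (H - V x y)

theorem limitDensity_pos (V : ℝ → ℝ → ℝ) (H j x y : ℝ) : 0 < limitDensity V H j x y := Finv_pos _ _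

theorem SmoothPeriodic2.exists_bound {V : ℝ → ℝ → ℝ} (hV : SmoothPeriodic2 V) :
    ∃ K : ℝ, ∀ x y, |V x y| ≤ K := by
  obtain ⟨K, -, hK⟩ := exists_bound_of_periodic_snd hV.1.continuous hV.2.2 0 1
  refine ⟨K, fun x y => ?_⟩
  rw [← periodic_map_fract (f := fun x => V x y) (fun x => hV.2.1 x y) x]
  exact hK _ ⟨Int.fract_nonneg _, (Int.fract_lt_one _).le⟩ y

/-! ### A priori estimates -/

namespace IsMFGSolution

variable {P ε H : ℝ} {V : ℝ → ℝ → ℝ} {u m : ℝ → ℝ}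

theorem continuous_m (h : IsMFGSolution P V ε u m H) : Continuous m := h.smooth_m.1.continuous

theorem continuous_deriv_u (h : IsMFGSolution P V ε u m H) : Continuous (deriv u) :=
  h.smooth_u.1.continuous_deriv (by simp)

theorem differentiable_u (h : IsMFGSolution P V ε u m H) : Differentiable ℝ u :=
  h.smooth_u.1.differentiable (by simp)

theorem differentiable_current (h : IsMFGSolution P V ε u m H) :
    Differentiable ℝ (current P u m) := by
  have h1 : ContDiff ℝ ∞ (deriv u) := (contDiff_infty_iff_deriv.1 h.smooth_u.1).2
  exact (h.smooth_m.1.differentiable (by simp)).mul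
    ((differentiable_const P).add (h1.differentiable (by simp)))

theorem current_eq (h : IsMFGSolution P V ε u m H) {x : ℝ} (hx : x ∈ Icc (0 : ℝ) 1) :
    current P u m x = current P u m 0 := by
  refine constant_of_derivWithin_zero h.differentiable_current.differentiableOn
    (fun y hy => ?_) x hx
  rw [(h.differentiable_current y).derivWithin
    (uniqueDiffOn_Icc_zero_one y (Ico_subset_Icc_self hy))]
  exact neg_eq_zero.1 (h.fokker_planck y (Ico_subset_Icc_self hy))

theorem deriv_u_eq (h : IsMFGSolution P V ε u m H) {x : ℝ} (hx : x ∈ Icc (0 : ℝ) 1) :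
    deriv u x = current P u m 0 * (m x)⁻¹ - P := by
  have := h.m_pos x
  rw [← h.current_eq hx, current]
  field_simp
  ring

theorem F_m (h : IsMFGSolution P V ε u m H) {x : ℝ} (hx : x ∈ Icc (0 : ℝ) 1) :
    F (current P u m 0) (m x) = H - V x (x / ε) := by
  have h1 := h.hamilton_jacobi x hx
  have := h.m_pos x
  rw [F, ← h.current_eq hx, current]
  have : (m x * (P + deriv u x)) ^ 2 / (2 * m x ^ 2) = (P + deriv u x) ^ 2 / 2 := by
    field_simp
  rw [this]; linarith

theorem exists_m_eq_one (h : IsMFGSolution P V ε u m H) : ∃ x ∈ Icc (0 : ℝ) 1, m x = 1 := by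
  obtain ⟨c, hc, hcm⟩ := exists_eq_interval_average (zero_ne_one' ℝ)
    h.continuous_m.continuousOn (f := m)
  rw [interval_average_eq, h.mass_m] at hcm
  rw [uIoo_of_le zero_le_one] at hc
  exact ⟨c, Ioo_subset_Icc_self hc, by simpa using hcm⟩

/-- Comparison with a point where `m = 1`: the unknown `H` cancels and the difference of `F` values
is a difference of two values of `V`. -/
theorem abs_log_m_le (h : IsMFGSolution P V ε u m H) {K : ℝ} (hK : ∀ x y, |V x y| ≤ K)
    (x : ℝ) : |Real.log (m x)| ≤ 2 * K := by
  -- The equation is available only on `[0,1]`; `V x (x / ε)` need not be 1-periodic in `x`, but `m`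
  -- is.
  rw [← periodic_map_fract h.smooth_m.2 x]
  have hx : Int.fract x ∈ Icc (0 : ℝ) 1 := ⟨Int.fract_nonneg _, (Int.fract_lt_one _).le⟩
  obtain ⟨x₀, hx₀, hm⟩ := h.exists_m_eq_one
  have := abs_log_sub_log_le_abs_F_sub (current P u m 0) (h.m_pos (Int.fract x)) (h.m_pos x₀)
  rw [h.F_m hx, h.F_m hx₀, hm, Real.log_one, sub_zero] at this
  refine this.trans ?_
  have h1 := abs_le.1 (hK x₀ (x₀ / ε))
  have h2 := abs_le.1 (hK (Int.fract x) (Int.fract x / ε))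
  exact abs_le.2 ⟨by linarith [h1.1, h2.2], by linarith [h1.2, h2.1]⟩

theorem m_le (h : IsMFGSolution P V ε u m H) {K : ℝ} (hK : ∀ x y, |V x y| ≤ K) (x : ℝ) :
    m x ≤ Real.exp (2 * K) :=
  (Real.log_le_iff_le_exp (h.m_pos x)).1 ((le_abs_self _).trans (h.abs_log_m_le hK x))

theorem inv_m_le (h : IsMFGSolution P V ε u m H) {K : ℝ} (hK : ∀ x y, |V x y| ≤ K) (x : ℝ) :
    (m x)⁻¹ ≤ Real.exp (2 * K) := by
  rw [← Real.log_le_iff_le_exp (inv_pos.2 (h.m_pos x)), Real.log_inv]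
  exact (neg_le_abs _).trans (h.abs_log_m_le hK x)

/-- By Rolle's theorem `u_x` vanishes at some `c`, where the current equals `m(c) P`. -/
theorem abs_current_le (h : IsMFGSolution P V ε u m H) {K : ℝ} (hK : ∀ x y, |V x y| ≤ K) :
    |current P u m 0| ≤ Real.exp (2 * K) * |P| := by
  obtain ⟨c, hc, hd⟩ := exists_deriv_eq_zero (f := u) zero_lt_one
    h.smooth_u.1.continuous.continuousOn (by simpa using (h.smooth_u.2 0).symm)
  rw [← h.current_eq (Ioo_subset_Icc_self hc), current, hd, add_zero, abs_mul,
    abs_of_pos (h.m_pos c)]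
  gcongr
  exact h.m_le hK c

theorem abs_H_le (h : IsMFGSolution P V ε u m H) {K : ℝ} (hK : ∀ x y, |V x y| ≤ K) :
    |H| ≤ K + (Real.exp (2 * K) * |P|) ^ 2 / 2 := by
  obtain ⟨x₀, hx₀, hm⟩ := h.exists_m_eq_one
  have h1 := h.F_m hx₀
  rw [hm, F, Real.log_one] at h1
  have h2 := abs_le.1 (hK x₀ (x₀ / ε))
  have h3 : current P u m 0 ^ 2 ≤ (Real.exp (2 * K) * |P|) ^ 2 := by
    rw [← sq_abs]
    gcongr
    exact h.abs_current_le hK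
  have h4 := sq_nonneg (current P u m 0)
  norm_num at h1
  exact abs_le.2 ⟨by linarith [h2.1], by linarith [h2.2]⟩

theorem u_eq (h : IsMFGSolution P V ε u m H) (x : ℝ) :
    u x = (∫ s in (0 : ℝ)..x, deriv u s) - ∫ z in (0 : ℝ)..1, ∫ s in (0 : ℝ)..z, deriv u s := by
  have e : ∀ z, ∫ s in (0 : ℝ)..z, deriv u s = u z - u 0 := fun z =>
    intervalIntegral.integral_deriv_eq_sub (fun y _ => h.differentiable_u y)
      (h.continuous_deriv_u.intervalIntegrable _ _)
  simp_rw [e]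
  rw [intervalIntegral.integral_sub (h.smooth_u.1.continuous.intervalIntegrable _ _) (by simp),
    h.mean_u]
  simp

end IsMFGSolution

/-! ### Asymptotics of the densities -/

section Asymptotics

variable {P : ℝ} {V : ℝ → ℝ → ℝ} {ε : ℕ → ℝ} {us ms : ℕ → ℝ → ℝ} {Hs : ℕ → ℝ} {H j : ℝ}

theorem isAsymptoticProfile_log (hV : SmoothPeriodic2 V)
    (hsol : ∀ n, IsMFGSolution P V (ε n) (us n) (ms n) (Hs n))
    (hH : Tendsto Hs atTop (𝓝 H)) (hj : Tendsto (fun n => current P (us n) (ms n) 0) atTop (𝓝 j)) :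
    IsAsymptoticProfile ε (fun n x => Real.log (ms n x))
      (fun x y => Real.log (limitDensity V H j x y)) where
  continuous_seq n := (hsol n).continuous_m.log fun x => ((hsol n).m_pos x).ne'
  continuous_profile := (continuous_log_Finv j).comp (continuous_const.sub hV.1.continuous)
  periodic x y := by simp only [limitDensity, hV.2.2]
  close η hη := by
    obtain ⟨K, hK⟩ := hV.exists_bound
    have hlim : Tendsto (fun n => |j ^ 2 - current P (us n) (ms n) 0 ^ 2| / 2 *
        Real.exp (2 * K) ^ 2 + |Hs n - H|) atTop (𝓝 0) := by
      have h1 := ((((hj.pow 2).const_sub (j ^ 2)).abs.div_const 2).mul_const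
        (Real.exp (2 * K) ^ 2)).add (hH.sub_const H).abs
      simpa using h1
    filter_upwards [hlim.eventually (ge_mem_nhds hη)] with n hn x hx
    have hm := (hsol n).m_pos x
    refine (abs_log_sub_log_le_abs_F_sub j hm (limitDensity_pos V H j _ _)).trans
      (le_trans ?_ hn)
    -- Both densities are measured with the limiting `F j`. The potential cancels, leaving only the
    -- errors in the two scalars, and `1 / m_n²` is bounded uniformly.
    have e : F j (ms n x) - F j (limitDensity V H j x (x / ε n))
        = (j ^ 2 - current P (us n) (ms n) 0 ^ 2) / 2 * (ms n x)⁻¹ ^ 2 + (Hs n - H) := by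
      have := (hsol n).F_m hx
      rw [limitDensity, F_Finv]
      rw [F] at this ⊢
      field_simp at this ⊢
      linarith
    rw [e]
    refine (abs_add_le _ _).trans ?_
    rw [abs_mul, abs_div, abs_of_pos (two_pos : (0 : ℝ) < 2), abs_pow, abs_inv, abs_of_pos hm]
    have := (hsol n).inv_m_le hK x
    have : 0 < (ms n x)⁻¹ := inv_pos.2 hm
    gcongr

theorem isAsymptoticProfile_m (hV : SmoothPeriodic2 V)
    (hsol : ∀ n, IsMFGSolution P V (ε n) (us n) (ms n) (Hs n))
    (hH : Tendsto Hs atTop (𝓝 H)) (hj : Tendsto (fun n => current P (us n) (ms n) 0) atTop (𝓝 j)) :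
    IsAsymptoticProfile ε ms (limitDensity V H j) := by
  have := (isAsymptoticProfile_log hV hsol hH hj).comp Real.continuous_exp
  simpa only [Real.exp_log (limitDensity_pos V H j _ _),
    fun n x => Real.exp_log ((hsol n).m_pos x)] using this

theorem continuous_inv_limitDensity (hV : SmoothPeriodic2 V) (H j : ℝ) :
    Continuous fun z : ℝ × ℝ => (limitDensity V H j z.1 z.2)⁻¹ := by
  have : Continuous fun z : ℝ × ℝ => Real.exp (-Real.log (Finv j (H - V z.1 z.2))) :=
    Real.continuous_exp.comp
      ((continuous_log_Finv j).comp (continuous_const.sub hV.1.continuous)).neg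
  simp only [Real.exp_neg, Real.exp_log (Finv_pos _ _)] at this
  exact this

theorem isAsymptoticProfile_deriv_u (hV : SmoothPeriodic2 V)
    (hsol : ∀ n, IsMFGSolution P V (ε n) (us n) (ms n) (Hs n))
    (hH : Tendsto Hs atTop (𝓝 H)) (hj : Tendsto (fun n => current P (us n) (ms n) 0) atTop (𝓝 j)) :
    IsAsymptoticProfile ε (fun n => deriv (us n))
      (fun x y => j * (limitDensity V H j x y)⁻¹ - P) := by
  have h1 := (isAsymptoticProfile_log hV hsol hH hj).comp
    (Φ := fun t => Real.exp (-t)) (by fun_prop)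
  simp only [Real.exp_neg, Real.exp_log (limitDensity_pos V H j _ _),
    fun n x => Real.exp_log ((hsol n).m_pos x)] at h1
  exact ((h1.const_mul hj).comp (Φ := fun t => t - P) (by fun_prop)).congr
    (fun n => (hsol n).continuous_deriv_u) fun n x hx => (hsol n).deriv_u_eq hx

end Asymptotics

/-! ### The homogenized limit -/

theorem tendsto_eLpNorm_top_zero {w : ℕ → ℝ → ℝ}
    (h : ∀ η > 0, ∀ᶠ n in atTop, ∀ x ∈ Icc (0 : ℝ) 1, |w n x| ≤ η) :
    Tendsto (fun n => eLpNorm (w n) ⊤ cell) atTop (𝓝 0) := by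
  rw [ENNReal.tendsto_nhds_zero]
  intro η hη
  rcases eq_or_ne η ⊤ with rfl | hηt
  · simp
  filter_upwards [h η.toReal (ENNReal.toReal_pos hη.ne' hηt)] with n hn
  refine (eLpNorm_le_of_ae_bound (C := η.toReal) ?_).trans ?_
  · filter_upwards [ae_cell_mem] with x hx using hn x (Ioc_subset_Icc_self hx)
  · simp [ENNReal.ofReal_toReal hηt]

theorem exists_bound_of_periodic {f : ℝ → ℝ} (hf : Continuous f) (hper : Function.Periodic f 1) :
    ∃ B : ℝ≥0, ∀ x, |f x| ≤ B := by
  obtain ⟨B, hB0, hB⟩ := exists_bound_of_periodic_snd (G := fun _ y => f y) (by fun_prop)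
    (fun _ => hper) 0 0
  exact ⟨⟨B, hB0⟩, fun x => hB 0 (by simp) x⟩

/-- The function is Lipschitz, but an exponent strictly below 1 is wanted globally on `ℝ`;
interpolating with boundedness (exponent 0) gives exponent 1/2. -/
theorem exists_holderWith_of_periodic {f f' : ℝ → ℝ} (hf : ∀ x, HasDerivAt f (f' x) x)
    (hf' : Continuous f') (hper : Function.Periodic f 1) (hper' : Function.Periodic f' 1) :
    ∃ α : ℝ≥0, 0 < α ∧ α < 1 ∧ ∃ C : ℝ≥0, HolderWith C α f := by
  obtain ⟨L, hL⟩ := exists_bound_of_periodic hf' hper'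
  obtain ⟨B, hB⟩ := exists_bound_of_periodic
    (continuous_iff_continuousAt.2 fun x => (hf x).continuousAt) hper
  have h1 : HolderWith L 1 f := by
    refine (lipschitzWith_of_nnnorm_deriv_le (fun x => (hf x).differentiableAt) fun x => ?_).holderWith
    rw [(hf x).deriv]
    exact_mod_cast hL x
  have h0 : HolderWith (2 * B) 0 f := by
    intro x y
    rw [NNReal.coe_zero, ENNReal.rpow_zero, mul_one, edist_nndist, ENNReal.coe_le_coe,
      ← NNReal.coe_le_coe, coe_nndist, Real.dist_eq]
    push_cast
    have := abs_sub (f x) (f y)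
    linarith [hB x, hB y]
  have := h0.interpolate h1 (t₁ := 1 / 2) (t₂ := 1 / 2) (by norm_num)
  refine ⟨0 * (1 / 2) + 1 * (1 / 2), by norm_num, ?_, _, this⟩
  rw [zero_mul, zero_add, one_mul]
  exact NNReal.half_lt_self one_ne_zero

/-- The two-scale limit `j / m - P` of the derivatives of the value functions. -/
def limitGradient (P : ℝ) (V : ℝ → ℝ → ℝ) (H j x y : ℝ) : ℝ := j * (limitDensity V H j x y)⁻¹ - P

/-- The weak limit of the derivatives of the value functions. -/
def meanGradient (P : ℝ) (V : ℝ → ℝ → ℝ) (H j x : ℝ) : ℝ :=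
  ∫ y in (0 : ℝ)..1, limitGradient P V H j x y

/-- The limit of the value functions. -/
def limitValue (P : ℝ) (V : ℝ → ℝ → ℝ) (H j x : ℝ) : ℝ :=
  (∫ s in (0 : ℝ)..x, meanGradient P V H j s)
    - ∫ z in (0 : ℝ)..1, ∫ s in (0 : ℝ)..z, meanGradient P V H j s

section Limit

variable {P : ℝ} {V : ℝ → ℝ → ℝ} {ε : ℕ → ℝ} {us ms : ℕ → ℝ → ℝ} {Hs : ℕ → ℝ} {H j : ℝ}

theorem continuous_limitGradient (hV : SmoothPeriodic2 V) (P H j : ℝ) :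
    Continuous fun z : ℝ × ℝ => limitGradient P V H j z.1 z.2 :=
  ((continuous_inv_limitDensity hV H j).const_mul j).sub continuous_const

theorem continuous_meanGradient (hV : SmoothPeriodic2 V) (P H j : ℝ) :
    Continuous (meanGradient P V H j) := continuous_mean (continuous_limitGradient hV P H j)

theorem continuous_limitValue (hV : SmoothPeriodic2 V) (P H j : ℝ) :
    Continuous (limitValue P V H j) :=
  (continuous_primitive (continuous_meanGradient hV P H j)).sub continuous_const

theorem integral_meanGradient (hV : SmoothPeriodic2 V) (hε_pos : ∀ n, 0 < ε n)
    (hε : Tendsto ε atTop (𝓝 0)) (hsol : ∀ n, IsMFGSolution P V (ε n) (us n) (ms n) (Hs n))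
    (hH : Tendsto Hs atTop (𝓝 H)) (hj : Tendsto (fun n => current P (us n) (ms n) 0) atTop (𝓝 j)) :
    ∫ x in (0 : ℝ)..1, meanGradient P V H j x = 0 := by
  have h := (isAsymptoticProfile_deriv_u hV hsol hH hj).tendsto_integral hε_pos hε
  have h0 : ∀ n, ∫ x in (0 : ℝ)..1, deriv (us n) x = 0 := fun n => by
    rw [intervalIntegral.integral_deriv_eq_sub (fun y _ => (hsol n).differentiable_u y)
      ((hsol n).continuous_deriv_u.intervalIntegrable _ _)]
    have := (hsol n).smooth_u.2 0
    rw [zero_add] at this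
    rw [this, sub_self]
  simp_rw [h0] at h
  exact tendsto_nhds_unique h tendsto_const_nhds

theorem us_close_limitValue (hV : SmoothPeriodic2 V) (hε_pos : ∀ n, 0 < ε n)
    (hε : Tendsto ε atTop (𝓝 0)) (hsol : ∀ n, IsMFGSolution P V (ε n) (us n) (ms n) (Hs n))
    (hH : Tendsto Hs atTop (𝓝 H)) (hj : Tendsto (fun n => current P (us n) (ms n) 0) atTop (𝓝 j))
    {η : ℝ} (hη : 0 < η) :
    ∀ᶠ n in atTop, ∀ x ∈ Icc (0 : ℝ) 1, |us n x - limitValue P V H j x| ≤ η := by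
  filter_upwards [(isAsymptoticProfile_deriv_u hV hsol hH hj).integral_close hε_pos hε
    (half_pos hη)] with n hn x hx
  have h1 := hn x hx
  have h2 : |(∫ z in (0 : ℝ)..1, ∫ s in (0 : ℝ)..z, deriv (us n) s)
      - ∫ z in (0 : ℝ)..1, ∫ s in (0 : ℝ)..z, meanGradient P V H j s| ≤ η / 2 := by
    rw [← intervalIntegral.integral_sub
      ((continuous_primitive (hsol n).continuous_deriv_u).intervalIntegrable _ _)
      ((continuous_primitive (continuous_meanGradient hV P H j)).intervalIntegrable _ _)]
    simpa using intervalIntegral.norm_integral_le_of_norm_le_const (a := 0) (b := 1)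
      (f := fun z => (∫ s in (0 : ℝ)..z, deriv (us n) s)
        - ∫ s in (0 : ℝ)..z, meanGradient P V H j s) (C := η / 2) (fun z hz => by
        rw [uIoc_of_le zero_le_one] at hz
        exact hn z (Ioc_subset_Icc_self hz))
  rw [(hsol n).u_eq x, limitValue]
  change |_ - ∫ s in (0 : ℝ)..x, meanGradient P V H j s| ≤ η / 2 at h1
  rw [abs_le] at *
  constructor <;> linarith [h1.1, h1.2, h2.1, h2.2]

/-- The two-scale gradient splits into its cell mean, the derivative of the limit value, and a
fluctuation of mean zero in `y`, whose primitive is the corrector. -/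
theorem isHomogenizedLimit_of_tendsto (hV : SmoothPeriodic2 V) (hε_pos : ∀ n, 0 < ε n)
    (hε : Tendsto ε atTop (𝓝 0)) (hsol : ∀ n, IsMFGSolution P V (ε n) (us n) (ms n) (Hs n))
    (hH : Tendsto Hs atTop (𝓝 H)) (hj : Tendsto (fun n => current P (us n) (ms n) 0) atTop (𝓝 j))
    (q : ℝ≥0∞) :
    IsHomogenizedLimit P q ε us ms Hs (limitValue P V H j)
      (fun x y => ∫ s in (0 : ℝ)..y, (limitGradient P V H j x s - meanGradient P V H j x))
      (limitDensity V H j) H j := by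
  have hm := isAsymptoticProfile_m hV hsol hH hj
  have hu := isAsymptoticProfile_deriv_u hV hsol hH hj
  have hac := continuous_meanGradient hV P H j
  have haper : Function.Periodic (meanGradient P V H j) 1 := fun x => by
    simp only [meanGradient, limitGradient, limitDensity, hV.2.1]
  have ha0 := integral_meanGradient hV hε_pos hε hsol hH hj
  have hper : Function.Periodic (limitValue P V H j) 1 := fun x => by
    simp only [limitValue, periodic_primitive hac haper ha0 x]
  have hder : ∀ x, HasDerivAt (limitValue P V H j) (meanGradient P V H j x) x := fun x =>
    (hasDerivAt_primitive hac x).sub_const _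
  have hvc := continuous_limitValue hV P H j
  have hclose := fun η hη => us_close_limitValue hV hε_pos hε hsol hH hj (η := η) hη
  have hgc : Continuous fun z : ℝ × ℝ =>
      limitGradient P V H j z.1 z.2 - meanGradient P V H j z.1 :=
    (continuous_limitGradient hV P H j).sub (hac.comp continuous_fst)
  refine ⟨hper, exists_holderWith_of_periodic hder hac hper haper, ?_,
    (memLp_cell2_of_continuous hm.continuous_profile 1).integrable le_rfl, ?_,
    ⟨meanGradient P V H j, fun x y => limitGradient P V H j x y - meanGradient P V H j x,
      ⟨memLp_cell_of_continuous hvc q, memLp_cell_of_continuous hac q,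
        isWeakDeriv_of_hasDerivAt hder hac (by simpa using hper 0)⟩,
      ⟨⟨0, ?_⟩, memLp_cell2_of_continuous hgc q, ae_of_all _ fun x => ?_⟩,
      ?_, hu.weakLq hε_pos hε q, ?_⟩,
    tendsto_eLpNorm_top_zero hclose, hm.weakTwoScale hε_pos hε 1, hm.weakLq hε_pos hε 1, hH,
    fun x hx => by simpa only [(hsol _).current_eq hx] using hj⟩
  · unfold limitValue
    rw [intervalIntegral.integral_sub ((continuous_primitive hac).intervalIntegrable _ _) (by simp)]
    simp
  -- The total mass passes to the limit from the constant sequence 1.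
  · refine tendsto_nhds_unique (hm.tendsto_integral hε_pos hε) ?_
    simp only [(hsol _).mass_m, tendsto_const_nhds]
  · refine memLp_cell2_of_continuous ?_ q
    simp only [Pi.zero_apply, sub_zero]
    exact intervalIntegral.continuous_parametric_intervalIntegral_of_continuous (a₀ := 0)
      (f := fun (z : ℝ × ℝ) s => limitGradient P V H j z.1 s - meanGradient P V H j z.1)
      (hgc.comp (by fun_prop : Continuous fun p : (ℝ × ℝ) × ℝ => (p.1.1, p.2))) continuous_snd
  · have hgx := continuous_slice
      (G := fun x y => limitGradient P V H j x y - meanGradient P V H j x) hgc x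
    refine isWeakDeriv_of_hasDerivAt (hasDerivAt_primitive hgx) hgx ?_
    simp only
    rw [intervalIntegral.integral_same, intervalIntegral.integral_sub
      ((continuous_slice (continuous_limitGradient hV P H j) x).intervalIntegrable _ _)
      (by simp)]
    simp [meanGradient]
  -- Uniform convergence is the case of a profile that does not depend on the fast variable.
  · have hv : IsAsymptoticProfile ε us (fun x _ => limitValue P V H j x) :=
      { continuous_seq := fun n => (hsol n).smooth_u.1.continuous
        continuous_profile := by fun_prop
        periodic := fun _ _ => rfl
        close := hclose }
    simpa using hv.weakLq hε_pos hε q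
  · simp only [add_sub_cancel]
    exact hu.weakTwoScale hε_pos hε q

/-! ### Identification of an arbitrary homogenized limit -/

theorem IsHomogenizedLimit.tendsto_current {q : ℝ≥0∞} {u₀ : ℝ → ℝ} {u₁ m : ℝ → ℝ → ℝ}
    (h : IsHomogenizedLimit P q ε us ms Hs u₀ u₁ m H j) :
    Tendsto (fun n => current P (us n) (ms n) 0) atTop (𝓝 j) :=
  h.2.2.2.2.2.2.2.2.2.2 0 (by simp)

theorem IsHomogenizedLimit.tendsto_H {q : ℝ≥0∞} {u₀ : ℝ → ℝ} {u₁ m : ℝ → ℝ → ℝ}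
    (h : IsHomogenizedLimit P q ε us ms Hs u₀ u₁ m H j) : Tendsto Hs atTop (𝓝 H) :=
  h.2.2.2.2.2.2.2.2.2.1

theorem IsHomogenizedLimit.density_ae_eq (hV : SmoothPeriodic2 V) (hε_pos : ∀ n, 0 < ε n)
    (hε : Tendsto ε atTop (𝓝 0)) (hsol : ∀ n, IsMFGSolution P V (ε n) (us n) (ms n) (Hs n))
    {q : ℝ≥0∞} {u₀ : ℝ → ℝ} {u₁ m : ℝ → ℝ → ℝ}
    (h : IsHomogenizedLimit P q ε us ms Hs u₀ u₁ m H j) :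
    ∀ᵐ z ∂cell2, m z.1 z.2 = limitDensity V H j z.1 z.2 :=
  WeakTwoScale.ae_eq le_rfl h.2.2.2.2.2.2.2.1
    ((isAsymptoticProfile_m hV hsol h.tendsto_H h.tendsto_current).weakTwoScale hε_pos hε 1)

/-- Uniqueness of the `L^∞` limit gives equality almost everywhere; both functions are continuous,
`u₀` by its Hölder bound, so equality extends to the closed interval. -/
theorem IsHomogenizedLimit.value_eq (hV : SmoothPeriodic2 V) (hε_pos : ∀ n, 0 < ε n)
    (hε : Tendsto ε atTop (𝓝 0)) (hsol : ∀ n, IsMFGSolution P V (ε n) (us n) (ms n) (Hs n))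
    {q : ℝ≥0∞} {u₀ : ℝ → ℝ} {u₁ m : ℝ → ℝ → ℝ}
    (h : IsHomogenizedLimit P q ε us ms Hs u₀ u₁ m H j) {x : ℝ} (hx : x ∈ Icc (0 : ℝ) 1) :
    u₀ x = limitValue P V H j x := by
  obtain ⟨-, ⟨α, hα, -, C, hC⟩, -, -, -, -, hconv, -⟩ := id h
  have hu₀ : Continuous u₀ := hC.continuous hα
  have hvc := continuous_limitValue hV P H j
  have hconv' := tendsto_eLpNorm_top_zero fun η hη =>
    us_close_limitValue hV hε_pos hε hsol h.tendsto_H h.tendsto_current (η := η) hη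
  have hle : eLpNorm (fun x => u₀ x - limitValue P V H j x) ⊤ cell ≤ 0 := by
    have hsum := hconv'.add hconv
    rw [add_zero] at hsum
    refine ge_of_tendsto' hsum fun n => ?_
    have hun := (hsol n).smooth_u.1.continuous
    have := eLpNorm_sub_le (f := fun x => us n x - limitValue P V H j x)
      (g := fun x => us n x - u₀ x) (μ := cell) (p := ⊤)
      (hun.sub hvc).aestronglyMeasurable (hun.sub hu₀).aestronglyMeasurable le_top
    rwa [show ((fun x => us n x - limitValue P V H j x) - fun x => us n x - u₀ x)
      = fun x => u₀ x - limitValue P V H j x by ext x; simp only [Pi.sub_apply]; ring] at this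
  have hae : u₀ =ᵐ[cell] limitValue P V H j := by
    have := (eLpNorm_eq_zero_iff (hu₀.sub hvc).aestronglyMeasurable (by simp)).1
      (nonpos_iff_eq_zero.1 hle)
    filter_upwards [this] with x hx using sub_eq_zero.1 hx
  refine Measure.eqOn_Icc_of_ae_eq volume zero_ne_one ?_ hu₀.continuousOn hvc.continuousOn hx
  rwa [← restrict_Ioc_eq_restrict_Icc]

theorem limitGradient_eq (P : ℝ) (V : ℝ → ℝ → ℝ) (H j x y : ℝ) :
    limitGradient P V H j x y = j / limitDensity V H j x y - P := by
  rw [limitGradient, div_eq_mul_inv]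

theorem continuous_div_limitDensity (hV : SmoothPeriodic2 V) (H j c : ℝ) :
    Continuous fun z : ℝ × ℝ => c / limitDensity V H j z.1 z.2 := by
  simpa only [div_eq_mul_inv] using (continuous_inv_limitDensity hV H j).const_mul c

theorem primitive_meanGradient_eq (hV : SmoothPeriodic2 V) (P H j x : ℝ) :
    ∫ s in (0 : ℝ)..x, meanGradient P V H j s
      = (∫ s in (0 : ℝ)..x, ∫ y in (0 : ℝ)..1, j / limitDensity V H j s y) - P * x := by
  have hc := continuous_div_limitDensity hV H j j
  have e : ∀ s, meanGradient P V H j s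
      = (∫ y in (0 : ℝ)..1, j / limitDensity V H j s y) - P := fun s => by
    simp only [meanGradient, limitGradient_eq]
    rw [intervalIntegral.integral_sub
      ((continuous_slice (G := fun x y => j / limitDensity V H j x y) hc s).intervalIntegrable
        _ _) (by simp)]
    simp
  simp_rw [e]
  rw [intervalIntegral.integral_sub ((continuous_mean hc).intervalIntegrable _ _) (by simp)]
  simp [mul_comm]

theorem limitValue_eq (hV : SmoothPeriodic2 V) (P H j x : ℝ) :
    limitValue P V H j x
      = (∫ s in (0 : ℝ)..x, ∫ y in (0 : ℝ)..1, j / limitDensity V H j s y) - P * x + P / 2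
        - ∫ z in (0 : ℝ)..1, ∫ s in (0 : ℝ)..z, ∫ y in (0 : ℝ)..1, j / limitDensity V H j s y := by
  have hc := continuous_primitive (continuous_mean
    (G := fun x y => j / limitDensity V H j x y) (continuous_div_limitDensity hV H j j))
  rw [limitValue]
  simp_rw [primitive_meanGradient_eq hV]
  rw [intervalIntegral.integral_sub (hc.intervalIntegrable _ _)
    ((by fun_prop : Continuous fun z : ℝ => P * z).intervalIntegrable _ _),
    intervalIntegral.integral_const_mul, integral_id]
  ring

/-- Uniqueness of the two-scale limit of the gradients gives `du₁ = j / m - (P + du₀)` almost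
everywhere. On almost every slice the subtracted term is constant in `y`, and it must be the mean of
`j / m` because a weak derivative of a periodic function has mean zero. -/
theorem IsHomogenizedLimit.corrector_eq (hV : SmoothPeriodic2 V) (hε_pos : ∀ n, 0 < ε n)
    (hε : Tendsto ε atTop (𝓝 0)) (hsol : ∀ n, IsMFGSolution P V (ε n) (us n) (ms n) (Hs n))
    {q : ℝ≥0∞} (hq : 1 ≤ q) {u₀ : ℝ → ℝ} {u₁ m : ℝ → ℝ → ℝ}
    (h : IsHomogenizedLimit P q ε us ms Hs u₀ u₁ m H j) :
    ∀ᵐ x ∂cell, ∃ v : ℝ → ℝ, Continuous v ∧ Function.Periodic v 1 ∧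
      (∀ᵐ y ∂cell, u₁ x y = v y) ∧ ∀ y : ℝ,
        v y = v 0 + (∫ s in (0 : ℝ)..y, j / limitDensity V H j x s)
          - y * ∫ z in (0 : ℝ)..1, j / limitDensity V H j x z := by
  obtain ⟨-, -, -, -, -, ⟨du₀, du₁, -, ⟨⟨c, hc⟩, -, hw⟩, -, -, hts⟩, -⟩ := id h
  have hae := WeakTwoScale.ae_eq hq hts
    ((isAsymptoticProfile_deriv_u hV hsol h.tendsto_H h.tendsto_current).weakTwoScale hε_pos hε q)
  filter_upwards [Measure.ae_ae_of_ae_prod hae, hw, (hc.integrable hq).prod_right_ae]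
    with x hx hwx hix
  have hdc := continuous_slice (G := fun x y => j / limitDensity V H j x y)
    (continuous_div_limitDensity hV H j j) x
  set b := P + du₀ x with hb
  have hgc : Continuous fun y => j / limitDensity V H j x y - b := hdc.sub continuous_const
  -- Only `u₁ - c` is assumed to be in `L^q`, but `c x` is a constant on the slice.
  have hui : Integrable (u₁ x) cell := by
    refine (hix.add (integrable_const (c x))).congr (ae_of_all _ fun y => ?_)
    simp
  obtain ⟨h0, k, hk⟩ := hwx.ae_eq_const_add_primitive hui hgc (by
    filter_upwards [hx] with y hy
    rw [div_eq_mul_inv]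
    linarith)
  have hprim : ∀ y : ℝ, ∫ s in (0 : ℝ)..y, (j / limitDensity V H j x s - b)
      = (∫ s in (0 : ℝ)..y, j / limitDensity V H j x s) - y * b := fun y => by
    rw [intervalIntegral.integral_sub (hdc.intervalIntegrable _ _) (by simp)]
    simp
  have hb' : ∫ z in (0 : ℝ)..1, j / limitDensity V H j x z = b := by
    rw [hprim] at h0; linarith
  have hgper : Function.Periodic (fun y => j / limitDensity V H j x y - b) 1 := fun y => by
    simp only [limitDensity, hV.2.2]
  refine ⟨fun y => k + ∫ s in (0 : ℝ)..y, (j / limitDensity V H j x s - b),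
    continuous_const.add (continuous_primitive hgc), fun y => ?_, hk, fun y => ?_⟩
  · simp only [periodic_primitive hgc hgper h0 y]
  · simp only [intervalIntegral.integral_same, add_zero, hprim, hb']
    ring

/-- The limit gradient `j / m - P` inherits total mean zero from the periodicity of `u_n`; this is a
linear equation for the prefactor `j`. -/
theorem current_limit_eq (hV : SmoothPeriodic2 V) (hε_pos : ∀ n, 0 < ε n)
    (hε : Tendsto ε atTop (𝓝 0)) (hsol : ∀ n, IsMFGSolution P V (ε n) (us n) (ms n) (Hs n))
    (hH : Tendsto Hs atTop (𝓝 H)) (hj : Tendsto (fun n => current P (us n) (ms n) 0) atTop (𝓝 j)) :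
    j = P / ∫ x in (0 : ℝ)..1, ∫ y in (0 : ℝ)..1, 1 / limitDensity V H j x y := by
  have hc := continuous_div_limitDensity hV H j 1
  have hpos : 0 < ∫ x in (0 : ℝ)..1, ∫ y in (0 : ℝ)..1, 1 / limitDensity V H j x y := by
    refine intervalIntegral.intervalIntegral_pos_of_pos
      ((continuous_mean hc).intervalIntegrable _ _) (fun x => ?_) zero_lt_one
    exact intervalIntegral.intervalIntegral_pos_of_pos
      ((continuous_slice (G := fun x y => 1 / limitDensity V H j x y) hc x).intervalIntegrable
        _ _) (fun y => one_div_pos.2 (limitDensity_pos V H j x y)) zero_lt_one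
  have h0 := integral_meanGradient hV hε_pos hε hsol hH hj
  rw [primitive_meanGradient_eq hV] at h0
  simp_rw [div_eq_mul_one_div j, intervalIntegral.integral_const_mul] at h0
  rw [eq_div_iff hpos.ne']
  linarith

theorem exists_subseq_tendsto (hV : SmoothPeriodic2 V)
    (hsol : ∀ n, IsMFGSolution P V (ε n) (us n) (ms n) (Hs n)) :
    ∃ (φ : ℕ → ℕ) (H j : ℝ), StrictMono φ ∧ Tendsto (Hs ∘ φ) atTop (𝓝 H) ∧
      Tendsto (fun n => current P (us (φ n)) (ms (φ n)) 0) atTop (𝓝 j) := by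
  obtain ⟨K, hK⟩ := hV.exists_bound
  obtain ⟨⟨H, j⟩, -, φ, hφ, hlim⟩ := (isCompact_Icc.prod isCompact_Icc).tendsto_subseq
    (x := fun n => (Hs n, current P (us n) (ms n) 0))
    fun n => ⟨abs_le.1 ((hsol n).abs_H_le hK), abs_le.1 ((hsol n).abs_current_le hK)⟩
  exact ⟨φ, H, j, hφ, (continuous_fst.tendsto _).comp hlim, (continuous_snd.tendsto _).comp hlim⟩

end Limit

end PeriodicMFG
end

/-! ### The homogenization theorem -/

theorem mainTheorem7
    (P : ℝ) (V : ℝ → ℝ → ℝ) (hV : PeriodicMFG.SmoothPeriodic2 V)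
    (ε : ℕ → ℝ) (hε_pos : ∀ n, 0 < ε n) (hε : Tendsto ε atTop (𝓝 0))
    (us ms : ℕ → ℝ → ℝ) (Hs : ℕ → ℝ)
    (hsol : ∀ n, PeriodicMFG.IsMFGSolution P V (ε n) (us n) (ms n) (Hs n))
    (q : ℝ≥0∞) (hq1 : 1 ≤ q) (hq : q ≠ ⊤) :
    -- uniform bound of the densities
    (∃ C : ℝ, ∀ n x, |ms n x| ≤ C) ∧
    -- limits exist along a subsequence
    (∃ (φ : ℕ → ℕ) (u₀ : ℝ → ℝ) (u₁ m : ℝ → ℝ → ℝ) (H j : ℝ), StrictMono φ ∧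
      PeriodicMFG.IsHomogenizedLimit P q (ε ∘ φ) (us ∘ φ) (ms ∘ φ) (Hs ∘ φ) u₀ u₁ m H j) ∧
    -- all such limits are given by the explicit formulas
    (∀ (φ : ℕ → ℕ) (u₀ : ℝ → ℝ) (u₁ m : ℝ → ℝ → ℝ) (H j : ℝ), StrictMono φ →
      PeriodicMFG.IsHomogenizedLimit P q (ε ∘ φ) (us ∘ φ) (ms ∘ φ) (Hs ∘ φ) u₀ u₁ m H j →
      (∀ᵐ z ∂PeriodicMFG.cell2,
        0 < m z.1 z.2 ∧ m z.1 z.2 = PeriodicMFG.Finv j (H - V z.1 z.2)) ∧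
      (∀ p : ℝ≥0∞, 1 < p → p ≠ ⊤ → PeriodicMFG.StrongTwoScale p (ε ∘ φ) (ms ∘ φ) m) ∧
      Integrable (fun z : ℝ × ℝ => 1 / m z.1 z.2) PeriodicMFG.cell2 ∧
      j = P / (∫ x in (0 : ℝ)..1, ∫ y in (0 : ℝ)..1, 1 / m x y) ∧
      (∀ x ∈ Icc (0 : ℝ) 1,
        u₀ x = (∫ s in (0 : ℝ)..x, ∫ y in (0 : ℝ)..1, j / m s y) - P * x + P / 2
          - ∫ z in (0 : ℝ)..1, ∫ s in (0 : ℝ)..z, ∫ y in (0 : ℝ)..1, j / m s y) ∧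
      (∀ᵐ x ∂PeriodicMFG.cell, ∃ v : ℝ → ℝ, Continuous v ∧ Function.Periodic v 1 ∧
        (∀ᵐ y ∂PeriodicMFG.cell, u₁ x y = v y) ∧
        ∀ y ∈ Icc (0 : ℝ) 1,
          v y = v 0 + (∫ s in (0 : ℝ)..y, j / m x s) - y * ∫ z in (0 : ℝ)..1, j / m x z)) := by
  open PeriodicMFG in
  refine ⟨?_, ?_, ?_⟩
  · obtain ⟨K, hK⟩ := hV.exists_bound
    refine ⟨Real.exp (2 * K), fun n x => ?_⟩
    rw [abs_of_pos ((hsol n).m_pos x)]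
    exact (hsol n).m_le hK x
  · obtain ⟨φ, H, j, hφ, hH, hj⟩ := exists_subseq_tendsto hV hsol
    exact ⟨φ, _, _, _, H, j, hφ, isHomogenizedLimit_of_tendsto hV (fun n => hε_pos (φ n))
      (hε.comp hφ.tendsto_atTop) (fun n => hsol (φ n)) hH hj q⟩
  · intro φ u₀ u₁ m H j hφ hlim
    have hpos' : ∀ n, 0 < (ε ∘ φ) n := fun n => hε_pos (φ n)
    have hε' : Tendsto (ε ∘ φ) atTop (𝓝 0) := hε.comp hφ.tendsto_atTop
    have hsol' : ∀ n, IsMFGSolution P V ((ε ∘ φ) n) ((us ∘ φ) n) ((ms ∘ φ) n) ((Hs ∘ φ) n) :=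
      fun n => hsol (φ n)
    have hae := hlim.density_ae_eq hV hpos' hε' hsol'
    have haex : ∀ᵐ x ∂cell, ∀ᵐ y ∂cell, m x y = limitDensity V H j x y :=
      Measure.ae_ae_of_ae_prod hae
    have h01 : (0 : ℝ) ∈ Icc (0 : ℝ) 1 := by simp
    have h11 : (1 : ℝ) ∈ Icc (0 : ℝ) 1 := by simp
    -- One null set of `x` serves all `c` and `y`: the formulas need `c = 1` and `c = j`, and the
    -- corrector needs every `y` on the same slice.
    have hcell : ∀ᵐ x ∂cell, ∀ c : ℝ, ∀ y ∈ Icc (0 : ℝ) 1,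
        ∫ s in (0 : ℝ)..y, c / m x s = ∫ s in (0 : ℝ)..y, c / limitDensity V H j x s := by
      filter_upwards [haex] with x hx c y hy
      refine intervalIntegral_congr_cell ?_ h01 hy
      filter_upwards [hx] with s hs
      rw [hs]
    have hcell2 : ∀ c : ℝ, ∀ x ∈ Icc (0 : ℝ) 1, ∫ s in (0 : ℝ)..x, ∫ y in (0 : ℝ)..1, c / m s y
        = ∫ s in (0 : ℝ)..x, ∫ y in (0 : ℝ)..1, c / limitDensity V H j s y := by
      intro c x hx
      refine intervalIntegral_congr_cell ?_ h01 hx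
      filter_upwards [hcell] with s hs using hs c 1 h11
    have hm := isAsymptoticProfile_m hV hsol' hlim.tendsto_H hlim.tendsto_current
    refine ⟨?_, fun p hp1 hp => ?_, ?_, ?_, fun x hx => ?_, ?_⟩
    · filter_upwards [hae] with z hz
      rw [hz]
      exact ⟨limitDensity_pos V H j _ _, rfl⟩
    · obtain ⟨h1, h2, h3⟩ := hm.weakTwoScale hpos' hε' p
      refine ⟨⟨h1, h2.ae_eq (by filter_upwards [hae] with z hz using hz.symm), fun ψ hψ => ?_⟩, ?_⟩
      · convert h3 ψ hψ using 2
        refine intervalIntegral_congr_cell ?_ h01 h11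
        filter_upwards [haex] with x hx
        refine intervalIntegral_congr_cell ?_ h01 h11
        filter_upwards [hx] with y hy
        rw [hy]
      · rw [eLpNorm_congr_ae hae]
        exact hm.tendsto_eLpNorm hpos' hε' hp1.le hp
    · refine ((memLp_cell2_of_continuous (continuous_div_limitDensity hV H j 1) 1).integrable
        le_rfl).congr ?_
      filter_upwards [hae] with z hz
      rw [hz]
    · rw [hcell2 1 1 h11]
      exact current_limit_eq hV hpos' hε' hsol' hlim.tendsto_H hlim.tendsto_current
    · rw [hlim.value_eq hV hpos' hε' hsol' hx, limitValue_eq hV, hcell2 j x hx]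
      congr 1
      refine intervalIntegral_congr_cell ?_ h01 h11
      filter_upwards [ae_cell_mem] with z hz using (hcell2 j z (Ioc_subset_Icc_self hz)).symm
    · filter_upwards [hlim.corrector_eq hV hpos' hε' hsol' hq1, hcell] with x hx hcx
      obtain ⟨v, hvc, hvp, hv, hvf⟩ := hx
      refine ⟨v, hvc, hvp, hv, fun y hy => ?_⟩
      rw [hcx j y hy, hcx j 1 h11]
      exact hvf y
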